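/- Let $n\ge 5$ and let $B$ be the Killing form of $\mathfrak{so}(n)$. Let $e_{ab}=E_{ab}-E_{ba}$, and let $\mathfrak{so}(n)=\mathfrak{so}(n-2)\oplus\mathfrak m_{12}\oplus\mathfrak m_{13}\oplus\mathfrak m_{23}$ be the decomposition in which $\mathfrak{so}(n-2)$ acts on the first $n-2$ coordinates, $\mathfrak m_{12}=\mathrm{span}\{e_{i,n-1}: i\le n-2\}$, $\mathfrak m_{13}=\mathrm{span}\{e_{i,n}: i\le n-2\}$ and $\mathfrak m_{23}=\mathrm{span}\{e_{n-1,n}\}$. For $x_1,x_{12},x_{13},x_{23}>0$ consider the left-invariant Riemannian metric on $SO(n)$ determined by the $\mathrm{Ad}(SO(n-2))$-invariant scalar product $$\langle\ ,\ \rangle = x_1(-B)|_{\mathfrak{so}(n-2)}+x_{12}(-B)|_{\mathfrak m_{12}}+x_{13}(-B)|_{\mathfrak m_{13}}+x_{23}(-B)|_{\mathfrak m_{23}}$$ on $\mathfrak{so}(n)$ (the four summands being mutually orthogonal). Then: 1. The Ricci tensor of the metric is of the same diagonal form: it equals $r_1(-B)|_{\mathfrak{so}(n-2)}+r_{12}(-B)|_{\mathfrak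 m_{12}}+r_{13}(-B)|_{\mathfrak m_{13}}+r_{23}(-B)|_{\mathfrak m_{23}}$ for some real numbers $r_1,r_{12},r_{13},r_{23}$. In particular it vanishes on $\mathfrak m_{12}\times\mathfrak m_{13}$. 2. If the metric is Einstein, then it is naturally reductive with respect to $SO(n)\times L$ for some closed subgroup $L$ of $SO(n)$, where $SO(n)\times L$ acts on $SO(n)$ by $(a,l)\,y=ayl^{-1}$. 3. The metric is Einstein if and only if, up to a common positive factor, $(x_1,x_{12},x_{13},x_{23})$ is one of $$(1,1,1,1),\qquad \Big(\tfrac{n-3}{n-1},1,\tfrac{n-3}{n-1},1\Big),\qquad \Big(\tfrac{n-3}{n-1},\tfrac{n-3}{n-1},1,1\Big),$$ $$\Big(\tfrac{(n-4)(n-1)^2}{n^3-2n^2+n-4},\ \tfrac{(n-1)(n^2-3n+4)}{n^3-2n^2+n-4},\ \tfrac{(n-1)(n^2-3n+4)}{n^3-2n^2+n-4},\ 1\Big),$$ that is, one of exactly three metrics up to positive factors and the exchange of $\mathfrak m_{12}$ and $\mathfrak m_{13}$ (which interchanges the second and the third quadruple). 4. Every positive multiple of these four metrics is naturally reductive with respect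 to $SO(n)\times L$, where $L$ is, respectively, $SO(n)$ (the bi-invariant metric); $SO(n-1)$ acting on all coordinates but number $n-1$; $SO(n-1)$ acting on the first $n-1$ coordinates; $SO(n-2)\times SO(2)$ acting on the first $n-2$ and the last two coordinates. -/

import Mathlib

-- matrices form a Lie algebra under the commutator
attribute [local instance 100] LieRing.ofAssociativeRing

noncomputable section

/-! ## Left-invariant metrics: Levi-Civita connection and Ricci tensor

A left-invariant Riemannian metric on a Lie group is an inner product `g` on its Lie algebra `𝔤`,
the space of left-invariant vector fields.  For left-invariant fields `X, Y` the field `∇_X Y` is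
left-invariant and the functions `g(X, Y)` are constant, so the Levi-Civita connection is a bilinear
map `𝔤 × 𝔤 → 𝔤`. -/

section LeftInvariant

variable {𝔤 : Type*} [LieRing 𝔤] [LieAlgebra ℝ 𝔤]

/-- `D` is the Levi-Civita connection of the left-invariant metric `g`, on left-invariant fields
(`D X Y = ∇_X Y`): it is metric and torsion-free. -/
structure IsLeviCivita (g : LinearMap.BilinForm ℝ 𝔤) (D : 𝔤 →ₗ[ℝ] 𝔤 →ₗ[ℝ] 𝔤) : Prop where
  metric : ∀ X Y Z, g (D X Y) Z + g Y (D X Z) = 0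
  torsion_free : ∀ X Y, D X Y - D Y X = ⁅X, Y⁆

/-- The curvature tensor `R(X, Y) Z = ∇_X ∇_Y Z - ∇_Y ∇_X Z - ∇_[X,Y] Z`. -/
def curvature (D : 𝔤 →ₗ[ℝ] 𝔤 →ₗ[ℝ] 𝔤) (X Y Z : 𝔤) : 𝔤 :=
  D X (D Y Z) - D Y (D X Z) - D ⁅X, Y⁆ Z

/-- The Ricci tensor `r(Y, Z) = tr (X ↦ R(X, Y) Z)`. -/
def ricci (D : 𝔤 →ₗ[ℝ] 𝔤 →ₗ[ℝ] 𝔤) (Y Z : 𝔤) : ℝ :=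
  LinearMap.trace ℝ 𝔤
    { toFun := fun X => curvature D X Y Z
      map_add' := fun X X' => by
        simp only [curvature, map_add, add_lie, LinearMap.add_apply]; abel
      map_smul' := fun c X => by
        simp only [curvature, map_smul, smul_lie, LinearMap.smul_apply, RingHom.id_apply,
          smul_sub] }

/-- The bilinear form `r` is the Ricci tensor of the left-invariant metric `g`. -/
def IsRicciTensorOf (r g : LinearMap.BilinForm ℝ 𝔤) : Prop :=
  ∃ D : 𝔤 →ₗ[ℝ] 𝔤 →ₗ[ℝ] 𝔤, IsLeviCivita g D ∧ ∀ Y Z, r Y Z = ricci D Y Z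

/-- The left-invariant metric `g` is Einstein: its Ricci tensor is a constant multiple of it. -/
def IsEinstein (g : LinearMap.BilinForm ℝ 𝔤) : Prop :=
  ∃ lam : ℝ, IsRicciTensorOf (lam • g) g

end LeftInvariant

/-! ## Naturally reductive homogeneous spaces -/

/-- The naturally reductive condition
`⟨[X, Y]_𝔭, Z⟩ + ⟨Y, [X, Z]_𝔭⟩ = 0` for all `X, Y, Z ∈ 𝔭`,
for a decomposition `𝔥 = 𝔨 ⊕ 𝔭` and a form `b` on `𝔥`, of which only the restriction to the
complement `𝔭` of the isotropy algebra `𝔨` is used. -/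
def NaturallyReductiveCondition {𝔥 : Type*} [LieRing 𝔥] [LieAlgebra ℝ 𝔥]
    {𝔭 𝔨 : Submodule ℝ 𝔥} (h : IsCompl 𝔭 𝔨) (b : LinearMap.BilinForm ℝ 𝔥) : Prop :=
  ∀ X ∈ 𝔭, ∀ Y ∈ 𝔭, ∀ Z ∈ 𝔭,
    b (Submodule.projection 𝔭 𝔨 h ⁅X, Y⁆) Z + b Y (Submodule.projection 𝔭 𝔨 h ⁅X, Z⁆) = 0

/-- The compact Lie group `SO(n)`. -/
abbrev SO (n : ℕ) : Type := Matrix.specialOrthogonalGroup (Fin n) ℝ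

/-- The Lie algebra `𝔰𝔬(n)` of skew-symmetric real matrices. -/
abbrev so (n : ℕ) : LieSubalgebra ℝ (Matrix (Fin n) (Fin n) ℝ) :=
  LieAlgebra.Orthogonal.so (Fin n) ℝ

/-- The adjoint action `Ad(A) X = A X A⁻¹` of `SO(n)` on `𝔰𝔬(n)`; here `A⁻¹ = Aᵀ`. -/
def Ad {n : ℕ} (A : SO n) (X : so n) : so n :=
  ⟨A.1 * X.1 * A.1.transpose, by
    have h := (LieAlgebra.Orthogonal.mem_so (n := Fin n) (R := ℝ) X.1).1 X.2
    rw [LieAlgebra.Orthogonal.mem_so]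
    simp [Matrix.transpose_mul, h, Matrix.mul_assoc]⟩

/-- `𝔩` is the Lie algebra of the (closed) subgroup `L` of `SO(n)`. -/
def IsLieAlgebraOf {n : ℕ} (𝔩 : LieSubalgebra ℝ (so n)) (L : Subgroup (SO n)) : Prop :=
  ∀ X : so n, X ∈ 𝔩 ↔ ∀ t : ℝ, ∃ A ∈ L, A.1 = NormedSpace.exp (t • X.1)

/-- `Δ𝔩 ⊆ 𝔰𝔬(n) × 𝔩`, the Lie algebra of the isotropy group `ΔL = {(l, l)}` at the identity
of the action `(a, l) y = a y l⁻¹` of `SO(n) × L` on `SO(n)`. -/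
def isotropyAlgebra {n : ℕ} (𝔩 : LieSubalgebra ℝ (so n)) : Submodule ℝ (so n × 𝔩) :=
  LinearMap.range (LinearMap.prod (𝔩.incl : 𝔩 →ₗ[ℝ] so n) LinearMap.id)

/-- The differential `(X, Y) ↦ X - Y` at the identity of the orbit map `(a, l) ↦ a l⁻¹`. -/
def orbitDifferential {n : ℕ} (𝔩 : LieSubalgebra ℝ (so n)) : so n × 𝔩 →ₗ[ℝ] so n :=
  LinearMap.fst ℝ (so n) 𝔩 - (𝔩.incl : 𝔩 →ₗ[ℝ] so n) ∘ₗ LinearMap.snd ℝ (so n) 𝔩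

/-- The left-invariant metric `g` on `SO(n)` is naturally reductive with respect to `SO(n) × L`,
which acts by `(a, l) y = a y l⁻¹`: the action is isometric, and `(SO(n), g)`, regarded as
`(SO(n) × L)/ΔL`, satisfies the naturally reductive condition for some `Ad(ΔL)`-invariant
complement `𝔭` of `Δ𝔩`, on which the inner product is the one induced by `g`. -/
def IsNaturallyReductiveWrt {n : ℕ} (g : LinearMap.BilinForm ℝ (so n))
    (L : Subgroup (SO n)) : Prop :=
  IsClosed (L : Set (SO n)) ∧
  (∀ A ∈ L, ∀ X Y : so n, g (Ad A X) (Ad A Y) = g X Y) ∧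
  ∃ 𝔩 : LieSubalgebra ℝ (so n), IsLieAlgebraOf 𝔩 L ∧
    ∃ (𝔭 : Submodule ℝ (so n × 𝔩)) (h : IsCompl 𝔭 (isotropyAlgebra 𝔩)),
      (∀ A ∈ L, ∀ W ∈ 𝔭, ∀ W' : so n × 𝔩,
        W'.1 = Ad A W.1 → (W'.2 : so n) = Ad A (W.2 : so n) → W' ∈ 𝔭) ∧
      NaturallyReductiveCondition h (g.compl₁₂ (orbitDifferential 𝔩) (orbitDifferential 𝔩))

/-- The left-invariant metric `g` on `SO(n)` is naturally reductive, with respect to `SO(n) × L`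
for some closed subgroup `L` of `SO(n)`. -/
def IsNaturallyReductive {n : ℕ} (g : LinearMap.BilinForm ℝ (so n)) : Prop :=
  ∃ L : Subgroup (SO n), IsNaturallyReductiveWrt g L

/-! ## The scalar products for `n = (n - 2) + 1 + 1` -/

/-- The first `n - 2` coordinates. -/
def B₁ {n : ℕ} (i : Fin n) : Prop := i.val + 2 < n
/-- The coordinate number `n - 1` (counted from one). -/
def B₂ {n : ℕ} (i : Fin n) : Prop := i.val + 2 = n
/-- The last coordinate. -/
def B₃ {n : ℕ} (i : Fin n) : Prop := i.val + 1 = n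

open Classical in
/-- The projection of `𝔰𝔬(n)` onto the matrices supported in the blocks `P × Q` and `Q × P`:
it keeps the entries there, and sets all others to zero. -/
def blockPart {n : ℕ} (P Q : Fin n → Prop) : so n →ₗ[ℝ] so n where
  toFun X := ⟨Matrix.of fun i j => if P i ∧ Q j ∨ Q i ∧ P j then X.1 i j else 0, by
    have h := (LieAlgebra.Orthogonal.mem_so (n := Fin n) (R := ℝ) X.1).1 X.2
    rw [LieAlgebra.Orthogonal.mem_so]
    ext i j
    have hij : X.1 j i = - X.1 i j := congrFun (congrFun h i) j
    have hc : (P j ∧ Q i ∨ Q j ∧ P i) ↔ (P i ∧ Q j ∨ Q i ∧ P j) := by tauto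
    simp only [Matrix.transpose_apply, Matrix.of_apply, Matrix.neg_apply, hc, hij]
    split_ifs <;> simp⟩
  map_add' X Y := by
    apply Subtype.ext
    ext i j
    by_cases h : P i ∧ Q j ∨ Q i ∧ P j <;> simp [h]
  map_smul' c X := by
    apply Subtype.ext
    ext i j
    by_cases h : P i ∧ Q j ∨ Q i ∧ P j <;> simp [h]

/-- The form `-B` on the block part of `𝔰𝔬(n)` given by `P` and `Q`, extended by zero, where `B` is
the Killing form of `𝔰𝔬(n)`. -/
def negKillingOn {n : ℕ} (P Q : Fin n → Prop) : LinearMap.BilinForm ℝ (so n) :=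
  (-killingForm ℝ (so n)).compl₁₂ (blockPart P Q) (blockPart P Q)

/-- The form
`x₁ (-B)|_𝔰𝔬(n-2) + x₁₂ (-B)|_𝔪₁₂ + x₁₃ (-B)|_𝔪₁₃ + x₂₃ (-B)|_𝔪₂₃` on `𝔰𝔬(n)`. -/
def diagForm (n : ℕ) (x₁ x₁₂ x₁₃ x₂₃ : ℝ) : LinearMap.BilinForm ℝ (so n) :=
  x₁ • negKillingOn B₁ B₁ + x₁₂ • negKillingOn B₁ B₂ + x₁₃ • negKillingOn B₁ B₃
    + x₂₃ • negKillingOn B₂ B₃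

/-- The special orthogonal group of the coordinates satisfying `P`, as the subgroup of `SO(n)` that
fixes the other standard basis vectors. -/
def SOon {n : ℕ} (P : Fin n → Prop) : Subgroup (SO n) where
  carrier := {A | ∀ j, ¬ P j → A.1.mulVec (Pi.single j 1) = Pi.single j 1}
  mul_mem' {A A'} hA hA' j hj := by
    have h1 := hA j hj
    have h2 := hA' j hj
    simp only [Submonoid.coe_mul, ← Matrix.mulVec_mulVec, h2, h1]
  one_mem' j _ := Matrix.one_mulVec _
  inv_mem' {A} hA j hj := by
    have h1 := hA j hj
    have h2 : (A⁻¹).1 * A.1 = 1 := congrArg Subtype.val (inv_mul_cancel A)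
    have h3 := congrArg (fun v => (A⁻¹).1.mulVec v) h1
    simp only [Matrix.mulVec_mulVec, h2, Matrix.one_mulVec] at h3
    exact h3.symm

/-- `SO(n-2) × SO(2)`, acting on the first `n - 2` and on the last two coordinates. -/
def SOprod (n : ℕ) : Subgroup (SO n) := SOon B₁ ⊔ SOon (fun i => ¬ B₁ i)

/-- `SO(n-1)`, acting on all coordinates but number `n - 1` (counted from one); its Lie algebra
is `𝔰𝔬(n-2) ⊕ 𝔪₁₃`. -/
def SO₁₃ (n : ℕ) : Subgroup (SO n) := SOon (fun i => ¬ B₂ i)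

/-- `SO(n-1)`, acting on the first `n - 1` coordinates; its Lie algebra is `𝔰𝔬(n-2) ⊕ 𝔪₁₂`. -/
def SO₁₂ (n : ℕ) : Subgroup (SO n) := SOon (fun i => ¬ B₃ i)

/-- The number `(n-3)/(n-1)`. -/
def einsteinAlpha (n : ℕ) : ℝ := ((n : ℝ) - 3) / ((n : ℝ) - 1)

/-- The number `(n-4)(n-1)² / (n³-2n²+n-4)`. -/
def einsteinBeta (n : ℕ) : ℝ :=
  ((n : ℝ) - 4) * ((n : ℝ) - 1) ^ 2 / ((n : ℝ) ^ 3 - 2 * (n : ℝ) ^ 2 + (n : ℝ) - 4)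

/-- The number `(n-1)(n²-3n+4) / (n³-2n²+n-4)`. -/
def einsteinGamma (n : ℕ) : ℝ :=
  ((n : ℝ) - 1) * ((n : ℝ) ^ 2 - 3 * (n : ℝ) + 4) /
    ((n : ℝ) ^ 3 - 2 * (n : ℝ) ^ 2 + (n : ℝ) - 4)

end

/-!
Up to the factor `n - 2`, the Killing form of `𝔰𝔬(n)` is the trace form (`killingForm_so`), so that
all metrics considered are diagonal in the basis `e_ij`: they have the form
`∑ i j, w i j * X i j * Y i j` for a symmetric matrix `w` of positive weights. For arbitrary weights
the Levi-Civita connection is explicit (`leviCivita`), and it is the only one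
(`IsLeviCivita.unique`). Since `𝔰𝔬(n)` is unimodular, the Ricci tensor is `r(Y, Z) = -tr (A_Y A_Z)`
with `A_Y X = ∇_X Y` (`ricci_eq_neg_trace_comp`). It is diagonal again, with the weights
`∑ a ≠ q, c, (w_qc² - (w_ac - w_aq)²) / (4 w_ac w_aq)` (`ricci_leviCivita`). For weights that are
constant on the blocks these are constant on the blocks as well (`ricciWeight_blockWeight`).

With `m = n - 2`, the Einstein condition is therefore a system of four algebraic equations. The
difference of the equations for `𝔪₁₂` and `𝔪₁₃` has the factor `x₁₂ - x₁₃`. If `x₁₂ = x₁₃`, the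
system reduces to a quadratic equation with two rational roots. If not, then for `x₂₃ = 1` the
product of `x₁₂` and `x₁₃` is a rational function of their sum `s`, and `s` satisfies a quartic
equation with the root `2 m / (m + 1)` and no other root that comes from positive `x₁₂ ≠ x₁₃`
(`einstein_solve_of_ne`); this root gives the second and the third quadruple.

For natural reductivity, let `L` be a closed group of block matrices for a partition of the indices
into two classes, with Lie algebra `𝔩`, and let the metric be a multiple of `tr ((S X) Yᵀ)`, where
`S` multiplies the entries of each of the two diagonal blocks by a constant and fixes the other
entries. Then `S` commutes with `Ad L` and `ad 𝔩`, and `S X - X ∈ 𝔩` for all `X`. The subspace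
`𝔭 = {(S X, S X - X)}` of `𝔰𝔬(n) × 𝔩` is a complement of `Δ𝔩`, and the naturally reductive condition
on it follows from the invariance of the trace form (`isNaturallyReductiveWrt_entryForm`). All four
Einstein metrics are of this kind.
-/

noncomputable section

/-! ### The Levi-Civita connection and the Ricci tensor of a left-invariant metric -/

section LeftInvariant

variable {𝔤 : Type*} [LieRing 𝔤] [LieAlgebra ℝ 𝔤]

/-- The Levi-Civita connection does not change when the metric is scaled. -/
lemma IsLeviCivita.smul {g : LinearMap.BilinForm ℝ 𝔤} {D : 𝔤 →ₗ[ℝ] 𝔤 →ₗ[ℝ] 𝔤}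
    (h : IsLeviCivita g D) (c : ℝ) : IsLeviCivita (c • g) D where
  metric X Y Z := by
    simp only [LinearMap.smul_apply, smul_eq_mul, ← mul_add, h.metric, mul_zero]
  torsion_free := h.torsion_free

/-- A nondegenerate symmetric form has at most one Levi-Civita connection: the difference of two
is a trilinear form symmetric in the first two and skew in the last two arguments. -/
lemma IsLeviCivita.unique {g : LinearMap.BilinForm ℝ 𝔤} (hs : ∀ X Y, g X Y = g Y X)
    (hnd : ∀ X, (∀ Y, g X Y = 0) → X = 0) {D D' : 𝔤 →ₗ[ℝ] 𝔤 →ₗ[ℝ] 𝔤}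
    (h : IsLeviCivita g D) (h' : IsLeviCivita g D') : D = D' := by
  have sym : ∀ X Y Z, g (D X Y) Z - g (D' X Y) Z = g (D Y X) Z - g (D' Y X) Z := by
    intro X Y Z
    have e : D X Y - D' X Y = D Y X - D' Y X := by
      have := (h.torsion_free X Y).trans (h'.torsion_free X Y).symm
      rw [sub_eq_sub_iff_add_eq_add] at this ⊢
      rw [this, add_comm]
    simpa using congrArg (fun V => g V Z) e
  have skew : ∀ X Y Z, g (D X Y) Z - g (D' X Y) Z = -(g (D X Z) Y - g (D' X Z) Y) := by
    intro X Y Z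
    have h1 := h.metric X Y Z
    have h2 := h'.metric X Y Z
    rw [hs Y] at h1 h2
    linarith
  ext X Y
  rw [← sub_eq_zero]
  refine hnd _ fun Z => ?_
  rw [map_sub, LinearMap.sub_apply]
  linarith [sym X Y Z, skew Y X Z, sym Y Z X, skew Z Y X, sym Z X Y, skew X Z Y]

/-- With `A_Y X = ∇_X Y`, the Ricci tensor is `r(Y, Z) = -tr (A_Y ∘ A_Z)` as soon as all
`A_V` are traceless, which for a left-invariant metric expresses unimodularity. -/
lemma ricci_eq_neg_trace_comp {D : 𝔤 →ₗ[ℝ] 𝔤 →ₗ[ℝ] 𝔤} (tf : ∀ X Y, D X Y - D Y X = ⁅X, Y⁆)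
    (ht : ∀ V, LinearMap.trace ℝ 𝔤 (D.flip V) = 0) (Y Z : 𝔤) :
    ricci D Y Z = -LinearMap.trace ℝ 𝔤 (D.flip Y ∘ₗ D.flip Z) := by
  -- expand the curvature by torsion-freeness; the commutator with `ad Y` is traceless
  have key : ricci D Y Z = LinearMap.trace ℝ 𝔤 (D.flip (D Y Z) - D.flip Y ∘ₗ D.flip Z
      + (D.flip Z ∘ₗ (LieAlgebra.ad ℝ 𝔤 Y : 𝔤 →ₗ[ℝ] 𝔤)
          - (LieAlgebra.ad ℝ 𝔤 Y : 𝔤 →ₗ[ℝ] 𝔤) ∘ₗ D.flip Z)) := by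
    unfold ricci
    congr 1
    ext X
    have e1 : D Y (D X Z) = D (D X Z) Y + ⁅Y, D X Z⁆ := by rw [← tf Y (D X Z)]; abel
    have e2 : D ⁅X, Y⁆ Z = - D ⁅Y, X⁆ Z := by
      rw [← lie_skew Y X, map_neg, LinearMap.neg_apply, neg_neg]
    simp only [LinearMap.coe_mk, AddHom.coe_mk, curvature, e1, e2, LinearMap.add_apply,
      LinearMap.sub_apply, LinearMap.comp_apply, LinearMap.flip_apply, LieAlgebra.ad_apply]
    abel
  have comm := LinearMap.trace_mul_comm ℝ (D.flip Z) (LieAlgebra.ad ℝ 𝔤 Y : 𝔤 →ₗ[ℝ] 𝔤)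
  simp only [Module.End.mul_eq_comp] at comm
  rw [key, map_add, map_sub, map_sub, ht, comm]
  ring

end LeftInvariant

/-! ### Skew-symmetric matrices: traces and the Killing form -/

section SkewMatrices

variable {n : ℕ}

lemma so_apply_swap (X : so n) (i j : Fin n) : X.1 j i = -X.1 i j :=
  congrFun (congrFun ((LieAlgebra.Orthogonal.mem_so (n := Fin n) (R := ℝ) X.1).1 X.2) i) j

lemma so_apply_self (X : so n) (i : Fin n) : X.1 i i = 0 := by
  linarith [so_apply_swap X i i]

lemma so_ext {X Y : so n} (h : ∀ i j, X.1 i j = Y.1 i j) : X = Y :=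
  Subtype.ext (Matrix.ext h)

/-- The skew-symmetric matrix with given entries. -/
def soOf (f : Fin n → Fin n → ℝ) (hf : ∀ i j, f j i = -f i j) : so n :=
  ⟨Matrix.of f, (LieAlgebra.Orthogonal.mem_so _ _ _).2 (Matrix.ext fun i j => hf i j)⟩

@[simp] lemma soOf_apply (f : Fin n → Fin n → ℝ) (hf : ∀ i j, f j i = -f i j) (i j : Fin n) :
    (soOf f hf).1 i j = f i j := rfl

/-- The skew-symmetric part `(M - Mᵀ) / 2` of a matrix. -/
def skewPart (n : ℕ) : Matrix (Fin n) (Fin n) ℝ →ₗ[ℝ] so n where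
  toFun M := soOf (fun i j => (M i j - M j i) / 2) fun i j => by ring
  map_add' M N := so_ext fun i j => by simp; ring
  map_smul' c M := so_ext fun i j => by simp; ring

/-- The matrix `e_ij = E_ij - E_ji`. -/
def soUnit (i j : Fin n) : so n :=
  soOf (fun a b => (if a = i ∧ b = j then 1 else 0) - (if a = j ∧ b = i then 1 else 0))
    fun a b => by simp only [and_comm, neg_sub]

lemma soUnit_apply (i j a b : Fin n) : (soUnit i j).1 a b =
    (if a = i ∧ b = j then 1 else 0) - (if a = j ∧ b = i then 1 else 0) := rfl

lemma soUnit_swap (i j : Fin n) : soUnit j i = -soUnit i j :=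
  so_ext fun a b => by simp [soUnit_apply]

lemma sum_mul_soUnit (f : Fin n → ℝ) (i j b : Fin n) : ∑ d, f d * (soUnit i j).1 d b =
    (if b = j then f i else 0) - (if b = i then f j else 0) := by
  simp only [soUnit_apply, mul_sub, Finset.sum_sub_distrib, ite_and, mul_ite, mul_one, mul_zero,
    Finset.sum_ite_eq', Finset.mem_univ, if_true]

lemma sum_soUnit_mul (f : Fin n → ℝ) (i j a : Fin n) : ∑ d, (soUnit i j).1 a d * f d =
    (if a = i then f j else 0) - (if a = j then f i else 0) := by
  simp only [soUnit_apply, sub_mul, Finset.sum_sub_distrib, ite_and, ite_mul, one_mul, zero_mul]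
  congr 1 <;> split_ifs <;> simp

lemma so_smul_apply (c : ℝ) (X : so n) (i j : Fin n) : (c • X).1 i j = c * X.1 i j := rfl

lemma so_add_apply (X Y : so n) (i j : Fin n) : (X + Y).1 i j = X.1 i j + Y.1 i j := rfl

lemma so_sub_apply (X Y : so n) (i j : Fin n) : (X - Y).1 i j = X.1 i j - Y.1 i j := rfl

lemma so_neg_apply (X : so n) (i j : Fin n) : (-X).1 i j = -X.1 i j := rfl

lemma so_lie_apply (X Y : so n) (i j : Fin n) :
    (⁅X, Y⁆).1 i j = ∑ k, X.1 i k * Y.1 k j - ∑ k, Y.1 i k * X.1 k j := by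
  rw [LieSubalgebra.coe_bracket, Ring.lie_def, Matrix.sub_apply, Matrix.mul_apply,
    Matrix.mul_apply]

/-- The inclusion of `𝔰𝔬(n)` into the space of all matrices. -/
def soIncl (n : ℕ) : so n →ₗ[ℝ] Matrix (Fin n) (Fin n) ℝ where
  toFun X := X.1
  map_add' _ _ := rfl
  map_smul' _ _ := rfl

/-- The trace of an endomorphism of `𝔰𝔬(n)`, as a sum over all pairs of indices; each of the basis
vectors `e_ij`, `i < j`, is met twice. -/
lemma trace_so (f : so n →ₗ[ℝ] so n) :
    LinearMap.trace ℝ (so n) f = (∑ i, ∑ j, (f (soUnit i j)).1 i j) / 2 := by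
  have hid : skewPart n ∘ₗ soIncl n = LinearMap.id := by
    refine LinearMap.ext fun X => so_ext fun i j => ?_
    simp only [LinearMap.comp_apply, skewPart, LinearMap.coe_mk, AddHom.coe_mk, soOf_apply,
      soIncl, LinearMap.id_apply]
    rw [so_apply_swap X i j]; ring
  have h1 : LinearMap.trace ℝ (so n) f
      = LinearMap.trace ℝ _ (soIncl n ∘ₗ (f ∘ₗ skewPart n)) := by
    rw [LinearMap.trace_comp_comm', LinearMap.comp_assoc, hid, LinearMap.comp_id]
  rw [h1, LinearMap.trace_eq_matrix_trace ℝ (Matrix.stdBasis ℝ (Fin n) (Fin n)), Matrix.trace,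
    Fintype.sum_prod_type, Finset.sum_div]
  refine Finset.sum_congr rfl fun i _ => ?_
  rw [Finset.sum_div]
  refine Finset.sum_congr rfl fun j _ => ?_
  have hu : skewPart n (Matrix.single i j 1) = (1 / 2 : ℝ) • soUnit i j := so_ext fun a b => by
    simp only [skewPart, LinearMap.coe_mk, AddHom.coe_mk, soOf_apply, Matrix.single_apply,
      so_smul_apply, soUnit_apply, @eq_comm _ i, @eq_comm _ j]
    simp only [and_comm (a := b = i)]
    ring
  have hr (M : Matrix (Fin n) (Fin n) ℝ) :
      (Matrix.stdBasis ℝ (Fin n) (Fin n)).repr M (i, j) = M i j := by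
    simp [Matrix.stdBasis]
  rw [Matrix.diag_apply, LinearMap.toMatrix_apply, Matrix.stdBasis_eq_single, hr]
  simp only [LinearMap.comp_apply, hu, map_smul]
  change (1 / 2 : ℝ) * (f (soUnit i j)).1 i j = _
  ring

/-- `-B(X, Y) = -(n - 2) tr (X Y)`. -/
lemma killingForm_so (X Y : so n) :
    killingForm ℝ (so n) X Y = -((n : ℝ) - 2) * ∑ i, ∑ j, X.1 i j * Y.1 i j := by
  have h (i j : Fin n) : (⁅X, ⁅Y, soUnit i j⁆⁆).1 i j =
      (∑ c, X.1 i c * Y.1 c i) + (∑ c, Y.1 j c * X.1 c j) + 2 * (X.1 i j * Y.1 i j)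
        - (if i = j then (∑ c, X.1 i c * Y.1 c j) + ∑ c, Y.1 i c * X.1 c j else 0) := by
    simp only [so_lie_apply, sum_mul_soUnit, sum_soUnit_mul, mul_sub, sub_mul,
      Finset.sum_sub_distrib, mul_ite, ite_mul, mul_zero, zero_mul, if_true,
      Finset.sum_ite_eq', Finset.mem_univ, so_apply_self]
    by_cases hij : i = j
    · subst hij; simp [so_apply_self]
    · simp [hij, Ne.symm hij]; ring
  have hs (i : Fin n) : ∑ c, X.1 i c * Y.1 c i = -∑ c, X.1 i c * Y.1 i c := by
    rw [← Finset.sum_neg_distrib]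
    exact Finset.sum_congr rfl fun c _ => by rw [so_apply_swap Y i c]; ring
  have hs' (i : Fin n) : ∑ c, Y.1 i c * X.1 c i = -∑ c, X.1 i c * Y.1 i c := by
    rw [← Finset.sum_neg_distrib]
    exact Finset.sum_congr rfl fun c _ => by rw [so_apply_swap X i c]; ring
  rw [killingForm_apply_apply, trace_so]
  simp only [LinearMap.comp_apply, LieAlgebra.ad_apply, h, Finset.sum_sub_distrib,
    Finset.sum_add_distrib, Finset.sum_ite_eq, Finset.mem_univ, if_true, hs, hs',
    ← Finset.mul_sum, Finset.sum_neg_distrib, Finset.sum_const, Finset.card_univ,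
    Fintype.card_fin, nsmul_eq_mul]
  ring

end SkewMatrices

/-! ### Metrics that are diagonal in the basis `e_ij` -/

section WeightedForms

variable {n : ℕ}

/-- The form `∑ i j, w i j * X i j * Y i j` on `𝔰𝔬(n)`. -/
def entryForm (w : Fin n → Fin n → ℝ) : LinearMap.BilinForm ℝ (so n) :=
  LinearMap.mk₂ ℝ (fun X Y => ∑ i, ∑ j, w i j * (X.1 i j * Y.1 i j))
    (fun X X' Y => by
      simp only [so_add_apply, add_mul, mul_add, Finset.sum_add_distrib])
    (fun c X Y => by
      simp only [so_smul_apply, Finset.mul_sum, smul_eq_mul]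
      exact Finset.sum_congr rfl fun i _ => Finset.sum_congr rfl fun j _ => by ring)
    (fun X Y Y' => by
      simp only [so_add_apply, mul_add, Finset.sum_add_distrib])
    (fun c X Y => by
      simp only [so_smul_apply, Finset.mul_sum, smul_eq_mul]
      exact Finset.sum_congr rfl fun i _ => Finset.sum_congr rfl fun j _ => by ring)

lemma entryForm_apply (w : Fin n → Fin n → ℝ) (X Y : so n) :
    entryForm w X Y = ∑ i, ∑ j, w i j * (X.1 i j * Y.1 i j) := rfl

/-- Diagonal weights play no role. -/
lemma entryForm_congr {w w' : Fin n → Fin n → ℝ} (h : ∀ i j, i ≠ j → w i j = w' i j) :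
    entryForm w = entryForm w' := by
  refine LinearMap.ext₂ fun X Y => ?_
  rw [entryForm_apply, entryForm_apply]
  refine Finset.sum_congr rfl fun i _ => Finset.sum_congr rfl fun j _ => ?_
  by_cases hij : i = j
  · subst hij; simp [so_apply_self]
  · rw [h i j hij]

lemma entryForm_soUnit (w : Fin n → Fin n → ℝ) (hw : ∀ i j, w i j = w j i) {q c : Fin n}
    (X : so n) : entryForm w X (soUnit q c) = 2 * (w q c * X.1 q c) := by
  have : ∀ i, ∑ j, w i j * (X.1 i j * (soUnit q c).1 i j)
      = (if i = q then w i c * X.1 i c else 0) - (if i = c then w i q * X.1 i q else 0) := by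
    intro i
    rw [← sum_soUnit_mul (fun j => w i j * X.1 i j) q c i]
    exact Finset.sum_congr rfl fun j _ => by ring
  rw [entryForm_apply]
  simp only [this, Finset.sum_sub_distrib, Finset.sum_ite_eq', Finset.mem_univ, if_true]
  rw [hw c q, so_apply_swap X q c]; ring

/-- For weights `w` the coefficient of `e_ac` in `∇_{e_ab} e_bc`. -/
def connCoeff (w : Fin n → Fin n → ℝ) (a b c : Fin n) : ℝ :=
  (w a c + w b c - w a b) / (2 * w a c)

/-- The Levi-Civita connection of `entryForm w`. -/
def leviCivita (w : Fin n → Fin n → ℝ) : so n →ₗ[ℝ] so n →ₗ[ℝ] so n :=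
  LinearMap.mk₂ ℝ (fun X Y => soOf
      (fun a c => ∑ b, (connCoeff w a b c * (X.1 a b * Y.1 b c))
        - ∑ b, (connCoeff w c b a * (X.1 c b * Y.1 b a))) fun a c => by ring)
    (fun X X' Y => so_ext fun a c => by
      simp only [soOf_apply, so_add_apply, add_mul, mul_add, Finset.sum_add_distrib]; ring)
    (fun r X Y => so_ext fun a c => by
      simp only [soOf_apply, so_smul_apply, mul_sub, Finset.mul_sum]
      congr 1 <;> exact Finset.sum_congr rfl fun b _ => by ring)
    (fun X Y Y' => so_ext fun a c => by
      simp only [soOf_apply, so_add_apply, mul_add, Finset.sum_add_distrib]; ring)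
    (fun r X Y => so_ext fun a c => by
      simp only [soOf_apply, so_smul_apply, mul_sub, Finset.mul_sum]
      congr 1 <;> exact Finset.sum_congr rfl fun b _ => by ring)

lemma leviCivita_apply (w : Fin n → Fin n → ℝ) (X Y : so n) (a c : Fin n) :
    (leviCivita w X Y).1 a c = ∑ b, (connCoeff w a b c * (X.1 a b * Y.1 b c))
        - ∑ b, (connCoeff w c b a * (X.1 c b * Y.1 b a)) := rfl

/-- The form `⟨∇_X Y, Z⟩`; its skew-symmetry in `Y` and `Z` shows in the exchange of `a` and `b`. -/
lemma entryForm_leviCivita {w : Fin n → Fin n → ℝ} (hw : ∀ i j, w i j = w j i)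
    (h0 : ∀ i j, w i j ≠ 0) (X Y Z : so n) :
    entryForm w (leviCivita w X Y) Z =
      ∑ a, ∑ b, ∑ c, (w a c + w b c - w a b) * (X.1 a b * Y.1 b c * Z.1 a c) := by
  have e : ∀ a c, w a c * ((leviCivita w X Y).1 a c * Z.1 a c)
      = (∑ b, (w a c + w b c - w a b) * (X.1 a b * Y.1 b c * Z.1 a c)) / 2
        + (∑ b, (w c a + w b a - w c b) * (X.1 c b * Y.1 b a * Z.1 c a)) / 2 := by
    intro a c
    rw [leviCivita_apply, sub_mul, mul_sub, Finset.sum_mul, Finset.sum_mul, Finset.mul_sum,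
      Finset.mul_sum, Finset.sum_div, Finset.sum_div, sub_eq_add_neg, ← Finset.sum_neg_distrib]
    have := h0 a c
    congr 1 <;> refine Finset.sum_congr rfl fun b _ => ?_
    · rw [connCoeff]; field_simp
    · rw [connCoeff, hw c a, so_apply_swap Z a c]; field_simp
  rw [entryForm_apply]
  simp only [e, Finset.sum_add_distrib, ← Finset.sum_div]
  rw [Finset.sum_comm (f := fun a c => ∑ b, (w c a + w b a - w c b) * _), add_halves]
  exact Finset.sum_congr rfl fun a _ => Finset.sum_comm

lemma entryForm_symm (w : Fin n → Fin n → ℝ) (X Y : so n) : entryForm w X Y = entryForm w Y X := by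
  simp only [entryForm_apply, mul_comm]

lemma isLeviCivita_leviCivita {w : Fin n → Fin n → ℝ} (hw : ∀ i j, w i j = w j i)
    (h0 : ∀ i j, w i j ≠ 0) : IsLeviCivita (entryForm w) (leviCivita w) where
  metric X Y Z := by
    rw [entryForm_symm w Y, entryForm_leviCivita hw h0, entryForm_leviCivita hw h0,
      Finset.sum_comm (f := fun a b => ∑ c, _ * (X.1 a b * Z.1 b c * Y.1 a c)),
      ← Finset.sum_add_distrib]
    refine Finset.sum_eq_zero fun a _ => ?_
    rw [← Finset.sum_add_distrib]
    refine Finset.sum_eq_zero fun b _ => ?_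
    rw [← Finset.sum_add_distrib]
    refine Finset.sum_eq_zero fun c _ => ?_
    rw [so_apply_swap X a b, hw b a]; ring
  torsion_free X Y := so_ext fun a c => by
    simp only [so_sub_apply, leviCivita_apply, so_lie_apply]
    simp only [sub_sub_eq_add_sub, ← Finset.sum_sub_distrib]
    refine Finset.sum_congr rfl fun b _ => ?_
    have h := h0 a c
    simp only [connCoeff, hw c a, hw b c, hw b a]
    rw [so_apply_swap X b c, so_apply_swap Y a b, so_apply_swap Y b c, so_apply_swap X a b]
    field_simp
    ring

lemma IsLeviCivita.eq_leviCivita {w : Fin n → Fin n → ℝ} (hw : ∀ i j, w i j = w j i)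
    (h0 : ∀ i j, w i j ≠ 0) {D : so n →ₗ[ℝ] so n →ₗ[ℝ] so n}
    (h : IsLeviCivita (entryForm w) D) : D = leviCivita w := by
  refine h.unique (entryForm_symm w) (fun X hX => so_ext fun q c => ?_)
    (isLeviCivita_leviCivita hw h0)
  have := hX (soUnit q c)
  rw [entryForm_soUnit w hw] at this
  simpa [h0 q c] using this

/-- The coefficient of `Y q c * Z q c` in the Ricci tensor of `entryForm w`. -/
def ricciWeight (w : Fin n → Fin n → ℝ) (q c : Fin n) : ℝ :=
  ∑ a, if a = q ∨ a = c then 0 else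
    (w q c ^ 2 - (w a c - w a q) ^ 2) / (4 * (w a c * w a q))

/-- The two terms of the connection contribute the same to the trace. -/
lemma trace_leviCivita_flip_comp (w : Fin n → Fin n → ℝ) (Y : so n) (f : so n →ₗ[ℝ] so n) :
    LinearMap.trace ℝ (so n) ((leviCivita w).flip Y ∘ₗ f) =
      ∑ a, ∑ b, ∑ c, connCoeff w a b c * ((f (soUnit a c)).1 a b * Y.1 b c) := by
  have e : ∀ a c, (leviCivita w (f (soUnit a c)) Y).1 a c
      = ∑ b, connCoeff w a b c * ((f (soUnit a c)).1 a b * Y.1 b c)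
        + ∑ b, connCoeff w c b a * ((f (soUnit c a)).1 c b * Y.1 b a) := by
    intro a c
    rw [leviCivita_apply, sub_eq_add_neg, ← Finset.sum_neg_distrib]
    congr 1
    refine Finset.sum_congr rfl fun b _ => ?_
    rw [soUnit_swap a c, map_neg, so_neg_apply]; ring
  rw [trace_so]
  simp only [LinearMap.comp_apply, LinearMap.flip_apply, e, Finset.sum_add_distrib]
  rw [Finset.sum_comm (f := fun a c => ∑ b, connCoeff w c b a * _), ← two_mul,
    mul_div_cancel_left₀ _ two_ne_zero]
  exact Finset.sum_congr rfl fun a _ => Finset.sum_comm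

lemma leviCivita_soUnit (w : Fin n → Fin n → ℝ) (Z : so n) (a b c : Fin n) :
    (leviCivita w (soUnit a c) Z).1 a b = connCoeff w a c b * Z.1 c b
      - (if a = c then connCoeff w a a b * Z.1 a b else 0)
      + (if b = a then connCoeff w a c a * Z.1 a c else 0) := by
  have h1 := sum_soUnit_mul (fun d => connCoeff w a d b * Z.1 d b) a c a
  have h2 := sum_soUnit_mul (fun d => connCoeff w b d a * Z.1 d a) a c b
  have e1 : ∑ d, connCoeff w a d b * ((soUnit a c).1 a d * Z.1 d b)
      = ∑ d, (soUnit a c).1 a d * (connCoeff w a d b * Z.1 d b) :=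
    Finset.sum_congr rfl fun d _ => by ring
  have e2 : ∑ d, connCoeff w b d a * ((soUnit a c).1 b d * Z.1 d a)
      = ∑ d, (soUnit a c).1 b d * (connCoeff w b d a * Z.1 d a) :=
    Finset.sum_congr rfl fun d _ => by ring
  rw [leviCivita_apply, e1, e2, h1, h2, so_apply_self, so_apply_swap Z a c, if_pos rfl]
  by_cases hb : b = a
  · subst hb; simp
  · simp [hb]

/-- The Ricci tensor of a metric that is diagonal in the basis `e_ij` is diagonal too. -/
lemma ricci_leviCivita {w : Fin n → Fin n → ℝ} (hw : ∀ i j, w i j = w j i)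
    (h0 : ∀ i j, w i j ≠ 0) (Y Z : so n) :
    ricci (leviCivita w) Y Z = entryForm (ricciWeight w) Y Z := by
  rw [ricci_eq_neg_trace_comp (isLeviCivita_leviCivita hw h0).torsion_free,
    trace_leviCivita_flip_comp]
  · have e : entryForm (ricciWeight w) Y Z = ∑ a, ∑ b, ∑ c, (if a = b ∨ a = c then 0 else
        (w b c ^ 2 - (w a c - w a b) ^ 2) / (4 * (w a c * w a b))) * (Y.1 b c * Z.1 b c) := by
      rw [entryForm_apply, Finset.sum_comm]
      simp only [ricciWeight, Finset.sum_mul]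
      conv_rhs => rw [Finset.sum_comm]; enter [2, b]; rw [Finset.sum_comm]
      rw [Finset.sum_comm]
    rw [e]
    simp only [LinearMap.flip_apply, leviCivita_soUnit, ← Finset.sum_neg_distrib]
    refine Finset.sum_congr rfl fun a _ => Finset.sum_congr rfl fun b _ =>
      Finset.sum_congr rfl fun c _ => ?_
    by_cases hbc : b = c
    · subst hbc; simp [so_apply_self]
    by_cases hac : a = c
    · subst hac; simp [hbc]
    by_cases hab : a = b
    · subst hab; simp [hac, so_apply_swap Z a c]
    have h1 := h0 a b
    have h2 := h0 a c
    simp only [hab, hac, Ne.symm hab, or_self, if_false, connCoeff, so_apply_swap Z b c, hw c b]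
    field_simp
    ring
  · intro V
    have := trace_leviCivita_flip_comp w V LinearMap.id
    rw [LinearMap.comp_id] at this
    rw [this]
    refine Finset.sum_eq_zero fun a _ => Finset.sum_eq_zero fun b _ =>
      Finset.sum_eq_zero fun c _ => ?_
    -- the factor `(e_ac) a b` vanishes for `b ≠ c`, the factor `V b c` for `b = c`
    by_cases hbc : b = c
    · subst hbc; simp [so_apply_self]
    · have : ¬ (a = c ∧ b = a) := fun h => hbc (h.2.trans h.1)
      simp [soUnit_apply, hbc, this]

end WeightedForms

/-! ### The block metrics as diagonal metrics -/

section BlockWeights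

variable {n : ℕ}

lemma entryForm_smul (c : ℝ) (w : Fin n → Fin n → ℝ) :
    c • entryForm w = entryForm fun i j => c * w i j := by
  refine LinearMap.ext₂ fun X Y => ?_
  simp only [LinearMap.smul_apply, smul_eq_mul, entryForm_apply, Finset.mul_sum, mul_assoc]

lemma entryForm_injective {w w' : Fin n → Fin n → ℝ} (hw : ∀ i j, w i j = w j i)
    (hw' : ∀ i j, w' i j = w' j i) (h : entryForm w = entryForm w') {i j : Fin n} (hij : i ≠ j) :
    w i j = w' i j := by
  have := congrArg (fun g => g (soUnit i j) (soUnit i j)) h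
  simpa [entryForm_soUnit w hw, entryForm_soUnit w' hw', soUnit_apply, hij] using this

open Classical in
/-- The weight of the entry `i j` in `diagForm`; the irrelevant last two diagonal entries get the
weight `x₂₃`. -/
def blockWeight (x₁ x₁₂ x₁₃ x₂₃ : ℝ) (i j : Fin n) : ℝ :=
  if B₁ i then if B₁ j then x₁ else if B₂ j then x₁₂ else x₁₃
  else if B₁ j then if B₂ i then x₁₂ else x₁₃ else x₂₃

lemma blockWeight_symm (x₁ x₁₂ x₁₃ x₂₃ : ℝ) (i j : Fin n) :
    blockWeight x₁ x₁₂ x₁₃ x₂₃ i j = blockWeight x₁ x₁₂ x₁₃ x₂₃ j i := by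
  unfold blockWeight; split_ifs <;> rfl

lemma blockWeight_pos {x₁ x₁₂ x₁₃ x₂₃ : ℝ} (h₁ : 0 < x₁) (h₁₂ : 0 < x₁₂) (h₁₃ : 0 < x₁₃)
    (h₂₃ : 0 < x₂₃) (i j : Fin n) : 0 < blockWeight x₁ x₁₂ x₁₃ x₂₃ i j := by
  unfold blockWeight; split_ifs <;> assumption

lemma block_cases (i : Fin n) : (B₁ i ∧ ¬ B₂ i ∧ ¬ B₃ i) ∨ (¬ B₁ i ∧ B₂ i ∧ ¬ B₃ i) ∨
    (¬ B₁ i ∧ ¬ B₂ i ∧ B₃ i) := by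
  unfold B₁ B₂ B₃; omega

lemma B₂.eq {i j : Fin n} (hi : B₂ i) (hj : B₂ j) : i = j := by
  unfold B₂ at *; ext; omega

lemma B₃.eq {i j : Fin n} (hi : B₃ i) (hj : B₃ j) : i = j := by
  unfold B₃ at *; ext; omega

open Classical in
lemma negKillingOn_apply (P Q : Fin n → Prop) (X Y : so n) : negKillingOn P Q X Y =
    ((n : ℝ) - 2) * ∑ i, ∑ j, if P i ∧ Q j ∨ Q i ∧ P j then X.1 i j * Y.1 i j else 0 := by
  simp only [negKillingOn, LinearMap.compl₁₂_apply, LinearMap.neg_apply, killingForm_so]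
  rw [neg_mul, neg_neg]
  congr 1
  refine Finset.sum_congr rfl fun i _ => Finset.sum_congr rfl fun j _ => ?_
  simp only [blockPart, LinearMap.coe_mk, AddHom.coe_mk, Matrix.of_apply]
  split_ifs <;> simp

/-- The block metric is `n - 2` times the diagonal form with the block weights. -/
lemma diagForm_eq (x₁ x₁₂ x₁₃ x₂₃ : ℝ) :
    diagForm n x₁ x₁₂ x₁₃ x₂₃ = ((n : ℝ) - 2) • entryForm (blockWeight x₁ x₁₂ x₁₃ x₂₃) := by
  refine LinearMap.ext₂ fun X Y => ?_
  simp only [diagForm, LinearMap.add_apply, LinearMap.smul_apply, negKillingOn_apply, smul_eq_mul,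
    entryForm_apply, mul_left_comm _ ((n : ℝ) - 2), ← mul_add]
  congr 1
  simp only [Finset.mul_sum, ← Finset.sum_add_distrib]
  refine Finset.sum_congr rfl fun i _ => Finset.sum_congr rfl fun j _ => ?_
  by_cases hij : i = j
  · subst hij; simp [so_apply_self]
  unfold blockWeight
  rcases block_cases i with ⟨hi₁, hi₂, hi₃⟩ | ⟨hi₁, hi₂, hi₃⟩ | ⟨hi₁, hi₂, hi₃⟩ <;>
    rcases block_cases j with ⟨hj₁, hj₂, hj₃⟩ | ⟨hj₁, hj₂, hj₃⟩ | ⟨hj₁, hj₂, hj₃⟩ <;>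
    first
    | exact absurd (hi₂.eq hj₂) hij
    | exact absurd (hi₃.eq hj₃) hij
    | simp [hi₁, hi₂, hi₃, hj₁, hj₂, hj₃]

lemma smul_diagForm (c x₁ x₁₂ x₁₃ x₂₃ : ℝ) :
    c • diagForm n x₁ x₁₂ x₁₃ x₂₃ = diagForm n (c * x₁) (c * x₁₂) (c * x₁₃) (c * x₂₃) := by
  simp only [diagForm, smul_add, smul_smul]

lemma ricciWeight_symm {w : Fin n → Fin n → ℝ} (hw : ∀ i j, w i j = w j i) (q c : Fin n) :
    ricciWeight w q c = ricciWeight w c q := by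
  unfold ricciWeight
  refine Finset.sum_congr rfl fun a _ => ?_
  simp only [or_comm, hw c q, mul_comm (w a c)]
  congr 2; ring

end BlockWeights

/-! ### The Ricci tensor of a block metric -/

section RicciTensor

variable {m : ℕ}

/-- An index of the first block. -/
def idx₁ (k : Fin m) : Fin (m + 2) := k.castSucc.castSucc
/-- The last index but one. -/
def idx₂ (m : ℕ) : Fin (m + 2) := (Fin.last m).castSucc
/-- The last index. -/
def idx₃ (m : ℕ) : Fin (m + 2) := Fin.last (m + 1)

lemma B₁_idx₁ (k : Fin m) : B₁ (idx₁ k) := by simp [B₁, idx₁]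
lemma not_B₁_idx₂ : ¬ B₁ (idx₂ m) := by simp [B₁, idx₂]
lemma not_B₁_idx₃ : ¬ B₁ (idx₃ m) := by simp [B₁, idx₃]
lemma B₂_idx₂ : B₂ (idx₂ m) := by simp [B₂, idx₂]
lemma not_B₂_idx₃ : ¬ B₂ (idx₃ m) := by simp [B₂, idx₃]

lemma idx₁_inj {k l : Fin m} : idx₁ k = idx₁ l ↔ k = l := by simp [idx₁]

lemma idx₁_ne_idx₂ (k : Fin m) : idx₁ k ≠ idx₂ m := fun h => not_B₁_idx₂ (h ▸ B₁_idx₁ k)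
lemma idx₁_ne_idx₃ (k : Fin m) : idx₁ k ≠ idx₃ m := fun h => not_B₁_idx₃ (h ▸ B₁_idx₁ k)
lemma idx₂_ne_idx₃ : idx₂ m ≠ idx₃ m := fun h => not_B₂_idx₃ (h ▸ B₂_idx₂)

lemma idx_cases (i : Fin (m + 2)) : (∃ k, i = idx₁ k) ∨ i = idx₂ m ∨ i = idx₃ m := by
  refine Fin.lastCases (Or.inr (Or.inr rfl)) (fun j => ?_) i
  exact Fin.lastCases (Or.inr (Or.inl rfl)) (fun k => Or.inl ⟨k, rfl⟩) j

lemma sum_idx (f : Fin (m + 2) → ℝ) :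
    ∑ i, f i = ∑ k : Fin m, f (idx₁ k) + f (idx₂ m) + f (idx₃ m) := by
  rw [Fin.sum_univ_castSucc, Fin.sum_univ_castSucc]; rfl

lemma sum_ite_eq_zero_const (q : Fin m) (K : ℝ) :
    ∑ a, (if a = q then 0 else K) = ((m : ℝ) - 1) * K := by
  have : ∀ a, (if a = q then 0 else K) = K - if a = q then K else 0 := fun a => by
    split_ifs <;> simp
  simp only [this, Finset.sum_sub_distrib, Finset.sum_ite_eq', Finset.mem_univ, if_true,
    Finset.sum_const, Finset.card_univ, Fintype.card_fin, nsmul_eq_mul]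
  ring

lemma sum_ite_or_eq_zero_const {q c : Fin m} (h : q ≠ c) (K : ℝ) :
    ∑ a, (if a = q ∨ a = c then 0 else K) = ((m : ℝ) - 2) * K := by
  have : ∀ a, (if a = q ∨ a = c then 0 else K)
      = (K - if a = q then K else 0) - if a = c then K else 0 := fun a => by
    by_cases h1 : a = q
    · subst h1; simp [h]
    · by_cases h2 : a = c
      · subst h2; simp [h1]
      · simp [h1, h2]
  simp only [this, Finset.sum_sub_distrib, Finset.sum_ite_eq', Finset.mem_univ, if_true,
    Finset.sum_const, Finset.card_univ, Fintype.card_fin, nsmul_eq_mul]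
  ring

variable (x₁ x₁₂ x₁₃ x₂₃ : ℝ)

/-- The weight of the Ricci tensor on `𝔰𝔬(m)`. -/
def ric₁ (m : ℝ) (x₁ x₁₂ x₁₃ : ℝ) : ℝ :=
  (m - 2) / 4 + x₁ ^ 2 / (4 * x₁₂ ^ 2) + x₁ ^ 2 / (4 * x₁₃ ^ 2)

/-- The weight of the Ricci tensor on `𝔪₁₂`; exchanging `x₁₂` and `x₁₃` gives the one on `𝔪₁₃`. -/
def ric₁₂ (m : ℝ) (x₁ x₁₂ x₁₃ x₂₃ : ℝ) : ℝ :=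
  (m - 1) * ((x₁₂ ^ 2 - (x₁₂ - x₁) ^ 2) / (4 * (x₁₂ * x₁)))
    + (x₁₂ ^ 2 - (x₂₃ - x₁₃) ^ 2) / (4 * (x₂₃ * x₁₃))

/-- The weight of the Ricci tensor on `𝔪₂₃`. -/
def ric₂₃ (m : ℝ) (x₁₂ x₁₃ x₂₃ : ℝ) : ℝ :=
  m * ((x₂₃ ^ 2 - (x₁₃ - x₁₂) ^ 2) / (4 * (x₁₃ * x₁₂)))

/-- For `x₁₂` the sum in `ricciWeight` has `m - 1` equal terms from the first block and one term
from the last index; the other cases are similar. -/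
lemma ricciWeight_blockWeight {x₁ : ℝ} (h₁ : x₁ ≠ 0) {i j : Fin (m + 2)} (hij : i ≠ j) :
    ricciWeight (blockWeight x₁ x₁₂ x₁₃ x₂₃) i j =
      blockWeight (ric₁ m x₁ x₁₂ x₁₃) (ric₁₂ m x₁ x₁₂ x₁₃ x₂₃) (ric₁₂ m x₁ x₁₃ x₁₂ x₂₃)
        (ric₂₃ m x₁₂ x₁₃ x₂₃) i j := by
  have s := ricciWeight_symm (blockWeight_symm (n := m + 2) x₁ x₁₂ x₁₃ x₂₃)
  have c12 (k : Fin m) : ricciWeight (blockWeight x₁ x₁₂ x₁₃ x₂₃) (idx₁ k) (idx₂ m)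
      = ric₁₂ m x₁ x₁₂ x₁₃ x₂₃ := by
    rw [ricciWeight, sum_idx]
    simp only [idx₁_inj, idx₁_ne_idx₂, idx₂_ne_idx₃.symm, (idx₁_ne_idx₂ k).symm,
      (idx₁_ne_idx₃ k).symm, or_false, or_true, if_true, if_false,
      blockWeight, B₁_idx₁, not_B₁_idx₂, not_B₁_idx₃, B₂_idx₂, not_B₂_idx₃,
      sum_ite_eq_zero_const, ric₁₂, add_zero]
  have c13 (k : Fin m) : ricciWeight (blockWeight x₁ x₁₂ x₁₃ x₂₃) (idx₁ k) (idx₃ m)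
      = ric₁₂ m x₁ x₁₃ x₁₂ x₂₃ := by
    rw [ricciWeight, sum_idx]
    simp only [idx₁_inj, idx₁_ne_idx₃, idx₂_ne_idx₃, (idx₁_ne_idx₂ k).symm,
      (idx₁_ne_idx₃ k).symm, or_false, or_true, if_true, if_false,
      blockWeight, B₁_idx₁, not_B₁_idx₂, not_B₁_idx₃, B₂_idx₂, not_B₂_idx₃,
      sum_ite_eq_zero_const, ric₁₂, add_zero]
  have c23 : ricciWeight (blockWeight x₁ x₁₂ x₁₃ x₂₃) (idx₂ m) (idx₃ m)
      = ric₂₃ m x₁₂ x₁₃ x₂₃ := by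
    rw [ricciWeight, sum_idx]
    simp only [idx₁_ne_idx₂, idx₁_ne_idx₃, idx₂_ne_idx₃, or_false, or_true, if_true, if_false,
      blockWeight, B₁_idx₁, not_B₁_idx₂, not_B₁_idx₃, B₂_idx₂, not_B₂_idx₃,
      Finset.sum_const, Finset.card_univ, Fintype.card_fin, nsmul_eq_mul, ric₂₃, add_zero]
  rcases idx_cases i with ⟨k, rfl⟩ | rfl | rfl <;> rcases idx_cases j with ⟨l, rfl⟩ | rfl | rfl
  · have hkl : k ≠ l := fun h => hij (h ▸ rfl)
    rw [ricciWeight, sum_idx]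
    simp only [idx₁_inj, (idx₁_ne_idx₂ _).symm, (idx₁_ne_idx₃ _).symm, or_false, if_false,
      blockWeight, B₁_idx₁, if_true, not_B₁_idx₂, not_B₁_idx₃, B₂_idx₂, not_B₂_idx₃,
      sum_ite_or_eq_zero_const hkl, ric₁, sub_self]
    field_simp
    ring
  · rw [c12]; simp [blockWeight, B₁_idx₁, not_B₁_idx₂, B₂_idx₂]
  · rw [c13]; simp [blockWeight, B₁_idx₁, not_B₁_idx₃, not_B₂_idx₃]
  · rw [s, c12]; simp [blockWeight, B₁_idx₁, not_B₁_idx₂, B₂_idx₂]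
  · exact (hij rfl).elim
  · rw [c23]; simp [blockWeight, not_B₁_idx₂, not_B₁_idx₃]
  · rw [s, c13]; simp [blockWeight, B₁_idx₁, not_B₁_idx₃, not_B₂_idx₃]
  · rw [s, c23]; simp [blockWeight, not_B₁_idx₂, not_B₁_idx₃]
  · exact (hij rfl).elim

variable {x₁ x₁₂ x₁₃ x₂₃}

lemma ricci_leviCivita_blockWeight (h₁ : 0 < x₁) (h₁₂ : 0 < x₁₂) (h₁₃ : 0 < x₁₃) (h₂₃ : 0 < x₂₃)
    (Y Z : so (m + 2)) : ricci (leviCivita (blockWeight x₁ x₁₂ x₁₃ x₂₃)) Y Z =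
      entryForm (blockWeight (ric₁ m x₁ x₁₂ x₁₃) (ric₁₂ m x₁ x₁₂ x₁₃ x₂₃)
        (ric₁₂ m x₁ x₁₃ x₁₂ x₂₃) (ric₂₃ m x₁₂ x₁₃ x₂₃)) Y Z := by
  rw [ricci_leviCivita (blockWeight_symm _ _ _ _)
    fun i j => (blockWeight_pos h₁ h₁₂ h₁₃ h₂₃ i j).ne']
  rw [entryForm_congr fun i j hij => ricciWeight_blockWeight x₁₂ x₁₃ x₂₃ h₁.ne' hij]

/-- The Ricci tensor of a diagonal metric is diagonal. -/
lemma isRicciTensorOf_diagForm (hm : m ≠ 0)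
    (h₁ : 0 < x₁) (h₁₂ : 0 < x₁₂) (h₁₃ : 0 < x₁₃) (h₂₃ : 0 < x₂₃) :
    IsRicciTensorOf (diagForm (m + 2) ((m : ℝ)⁻¹ * ric₁ m x₁ x₁₂ x₁₃)
      ((m : ℝ)⁻¹ * ric₁₂ m x₁ x₁₂ x₁₃ x₂₃) ((m : ℝ)⁻¹ * ric₁₂ m x₁ x₁₃ x₁₂ x₂₃)
      ((m : ℝ)⁻¹ * ric₂₃ m x₁₂ x₁₃ x₂₃)) (diagForm (m + 2) x₁ x₁₂ x₁₃ x₂₃) := by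
  refine ⟨leviCivita (blockWeight x₁ x₁₂ x₁₃ x₂₃), ?_, fun Y Z => ?_⟩
  · rw [diagForm_eq]
    exact (isLeviCivita_leviCivita (blockWeight_symm _ _ _ _)
      fun i j => (blockWeight_pos h₁ h₁₂ h₁₃ h₂₃ i j).ne').smul _
  · have hm' : (m : ℝ) ≠ 0 := Nat.cast_ne_zero.2 hm
    rw [ricci_leviCivita_blockWeight h₁ h₁₂ h₁₃ h₂₃, ← smul_diagForm, diagForm_eq, smul_smul]
    simp [hm']

/-- The Einstein condition for a diagonal metric as a system of algebraic equations. -/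
lemma isEinstein_diagForm_iff (hm : 3 ≤ m)
    (h₁ : 0 < x₁) (h₁₂ : 0 < x₁₂) (h₁₃ : 0 < x₁₃) (h₂₃ : 0 < x₂₃) :
    IsEinstein (diagForm (m + 2) x₁ x₁₂ x₁₃ x₂₃) ↔
      ∃ lam : ℝ, ric₁ m x₁ x₁₂ x₁₃ = lam * x₁ ∧ ric₁₂ m x₁ x₁₂ x₁₃ x₂₃ = lam * x₁₂ ∧
        ric₁₂ m x₁ x₁₃ x₁₂ x₂₃ = lam * x₁₃ ∧ ric₂₃ m x₁₂ x₁₃ x₂₃ = lam * x₂₃ := by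
  have hm' : (m : ℝ) ≠ 0 := Nat.cast_ne_zero.2 (by omega)
  have hm2 : ((m + 2 : ℕ) : ℝ) - 2 = m := by push_cast; ring
  constructor
  · rintro ⟨lam, D, hD, hr⟩
    have hD' : D = leviCivita (blockWeight x₁ x₁₂ x₁₃ x₂₃) := by
      refine IsLeviCivita.eq_leviCivita (blockWeight_symm _ _ _ _)
        (fun i j => (blockWeight_pos h₁ h₁₂ h₁₃ h₂₃ i j).ne') ?_
      have := hD.smul (m : ℝ)⁻¹
      rwa [diagForm_eq, hm2, smul_smul, inv_mul_cancel₀ hm', one_smul] at this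
    subst hD'
    have e := LinearMap.ext₂ fun Y Z =>
      (hr Y Z).trans (ricci_leviCivita_blockWeight h₁ h₁₂ h₁₃ h₂₃ Y Z)
    rw [smul_diagForm, diagForm_eq, entryForm_smul] at e
    have key {i j : Fin (m + 2)} (hij : i ≠ j) := entryForm_injective
      (fun i j => by rw [blockWeight_symm]) (blockWeight_symm _ _ _ _) e hij
    rw [hm2] at key
    have e1 := key (i := idx₁ (⟨0, by omega⟩ : Fin m)) (j := idx₁ ⟨1, by omega⟩)
      (by simp [idx₁_inj])
    have e2 := key (idx₁_ne_idx₂ (⟨0, by omega⟩ : Fin m))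
    have e3 := key (idx₁_ne_idx₃ (⟨0, by omega⟩ : Fin m))
    have e4 := key (idx₂_ne_idx₃ (m := m))
    simp only [blockWeight, B₁_idx₁, not_B₁_idx₂, not_B₁_idx₃, B₂_idx₂, not_B₂_idx₃, if_true,
      if_false, ← mul_assoc] at e1 e2 e3 e4
    exact ⟨m * lam, e1.symm, e2.symm, e3.symm, e4.symm⟩
  · rintro ⟨lam, e1, e2, e3, e4⟩
    refine ⟨(m : ℝ)⁻¹ * lam, ?_⟩
    have := isRicciTensorOf_diagForm (by omega) h₁ h₁₂ h₁₃ h₂₃ (m := m)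
    rw [e1, e2, e3, e4] at this
    rw [smul_diagForm]
    simpa only [mul_assoc] using this

end RicciTensor

/-! ### Solution of the Einstein equations -/

section EinsteinEquations

variable {m x u v L : ℝ}

/-- The solutions with `x₁₂ = x₁₃`, for `x₂₃ = 1`. -/
lemma einstein_solve_of_eq
    (e1 : (m - 2) * u ^ 2 + 2 * x ^ 2 = L * x * u ^ 2)
    (e2 : (m - 1) * (2 * u - x) + (2 * u - 1) = L * u ^ 2) (e4 : m = L * u ^ 2) :
    (x = u ∨ (m ^ 2 + m + 2) * x = (m + 1) * (m - 2) * u) ∧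
      2 * m * u - (m - 1) * x = m + 1 := by
  have h : 2 * m * u - (m - 1) * x = m + 1 := by linear_combination e2 - e4
  refine ⟨?_, h⟩
  have hp : (x - u) * ((m ^ 2 + m + 2) * x - (m + 1) * (m - 2) * u) = 0 := by
    linear_combination (m + 1) * e1 - (m + 1) * x * e4 - m * x * h
  rcases mul_eq_zero.1 hp with h' | h'
  · exact Or.inl (sub_eq_zero.1 h')
  · exact Or.inr (sub_eq_zero.1 h')

/-- The cubic factor in `einstein_solve_of_ne`. -/
lemma einstein_cubic_neg {m s : ℝ} (hm : 3 ≤ m) (hs0 : 0 < s) (hs2 : s < 2) :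
    2 * m * s ^ 3 - 4 * m * s ^ 2 - (m ^ 2 - 5 * m - 2) * s - m * (m ^ 2 + m + 2) < 0 := by
  have hm0 : 0 < m := by linarith
  have h1 : 2 * m * s ^ 2 * (s - 2) < 0 :=
    mul_neg_of_pos_of_neg (by positivity) (by linarith)
  have h3 : 2 * -(m ^ 2 - 5 * m - 2) ≤ m * (m ^ 2 + m + 2) := by
    have := mul_nonneg (sub_nonneg.2 hm) (by positivity : 0 ≤ m ^ 2 + 6 * m + 10)
    linarith
  have h2 : -(m ^ 2 - 5 * m - 2) * s ≤ m * (m ^ 2 + m + 2) := by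
    rcases le_total (-(m ^ 2 - 5 * m - 2)) 0 with h | h
    · exact (mul_nonpos_of_nonpos_of_nonneg h hs0.le).trans (by positivity)
    · exact (mul_le_mul_of_nonneg_left hs2.le h).trans (by linarith)
  linarith

/-- The solutions with `x₁₂ ≠ x₁₃`, for `x₂₃ = 1`, in terms of the sum and the product of `x₁₂` and
`x₁₃`. The sum `s` satisfies a quartic equation with the factor `(m + 1) s - 2 m`; the remaining
cubic is negative for `0 < s < 2`, and `s < 2` because `s ^ 2` exceeds four times the product. -/
lemma einstein_solve_of_ne (hm : 3 ≤ m) (hu : 0 < u) (hv : 0 < v) (huv : u ≠ v)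
    (e1 : (m - 2) * (u * v) ^ 2 + x ^ 2 * (u ^ 2 + v ^ 2) = L * x * (u * v) ^ 2)
    (e2 : (m - 1) * (2 * u - x) * v + u * (u ^ 2 - (1 - v) ^ 2) = L * u ^ 2 * v)
    (e3 : (m - 1) * (2 * v - x) * u + v * (v ^ 2 - (1 - u) ^ 2) = L * v ^ 2 * u)
    (e4 : m * (1 - (v - u) ^ 2) = L * (u * v)) :
    (m + 1) * (u + v) = 2 * m ∧ (m + 1) * (u * v) = m - 1 ∧ (m + 1) * x = m - 1 := by
  have hm0 : 0 < m := by linarith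
  obtain ⟨s, hs⟩ : ∃ s, s = u + v := ⟨_, rfl⟩
  obtain ⟨p, hp⟩ : ∃ p, p = u * v := ⟨_, rfl⟩
  have hs0 : 0 < s := by rw [hs]; positivity
  have hp0 : 0 < p := by rw [hp]; positivity
  have hdisc : 4 * p < s ^ 2 := by
    have := sq_pos_of_ne_zero (sub_ne_zero.2 huv)
    rw [hs, hp]; linarith [this, (by ring : (u - v) ^ 2 = (u + v) ^ 2 - 4 * (u * v))]
  have hx : (m - 1) * x * s = 2 * p * (m - s) := by
    -- the difference of the equations `e2` and `e3`, freed of the factor `u - v`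
    refine mul_left_cancel₀ (sub_ne_zero.2 huv) ?_
    rw [hs, hp]
    linear_combination v * e2 - u * e3
  have hL : L * p = m * (1 - s ^ 2 + 4 * p) := by
    rw [hs, hp]; linear_combination -e4
  have hQ : 2 * p * ((2 * m + 1) * s - m) = (m + 1) * s * (s ^ 2 - 1) := by
    have hsum : (m - 1) * (2 * p * s - x * (s ^ 2 - 2 * p)) + p * (2 * s - 2) = 2 * L * p ^ 2 := by
      rw [hs, hp]; linear_combination v * e2 + u * e3
    -- the sum of the equations `e2` and `e3`, with `x` and `L` eliminated
    refine mul_left_cancel₀ hp0.ne' ?_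
    linear_combination (-1 / 2) * (s * hsum + (s ^ 2 - 2 * p) * hx + 2 * p * s * hL)
  have hquart : (m - 2) * (m - 1) ^ 2 * s ^ 2 + 4 * (m - s) ^ 2 * (s ^ 2 - 2 * p)
      = 2 * (m - s) * (m - 1) * s * (m * (1 - s ^ 2 + 4 * p)) := by
    have h1 : (m - 2) * p ^ 2 + x ^ 2 * (s ^ 2 - 2 * p) = L * x * p ^ 2 := by
      rw [hs, hp]; linear_combination e1
    refine mul_left_cancel₀ (pow_ne_zero 2 hp0.ne') ?_
    linear_combination (m - 1) ^ 2 * s ^ 2 * h1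
      - (s ^ 2 - 2 * p) * ((m - 1) * x * s + 2 * p * (m - s)) * hx
      + L * p ^ 2 * (m - 1) * s * hx + 2 * p ^ 2 * (m - 1) * s * (m - s) * hL
  have hprod : ((m + 1) * s - 2 * m) * (2 * m * s ^ 3 - 4 * m * s ^ 2 - (m ^ 2 - 5 * m - 2) * s
      - m * (m ^ 2 + m + 2)) = 0 := by
    -- eliminate `p` from `hquart` by `hQ`
    refine mul_left_cancel₀ hs0.ne' ?_
    linear_combination ((2 * m + 1) * s - m) * hquart
      + (4 * (m - s) ^ 2 + 4 * m * (m - s) * (m - 1) * s) * hQ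
  have hs2 : s < 2 := by
    -- for `s ≥ 2`, `hQ` would express `4 p` as a number larger than `s ^ 2`
    by_contra! h
    have hQ0 : 0 < (2 * m + 1) * s - m := by nlinarith
    have h1 : 4 * p * ((2 * m + 1) * s - m) < s ^ 2 * ((2 * m + 1) * s - m) :=
      mul_lt_mul_of_pos_right hdisc hQ0
    have h2 : s * (2 * (m + 1) * (s ^ 2 - 1)) < s * (s * ((2 * m + 1) * s - m)) := by
      linarith [hQ]
    have h3 := lt_of_mul_lt_mul_left h2 hs0.le
    nlinarith [mul_nonneg (zero_le_three.trans hm) (sub_nonneg.2 h),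
      mul_nonneg hs0.le (sub_nonneg.2 h)]
  have hcubic := einstein_cubic_neg hm hs0 hs2
  have hsv : (m + 1) * s = 2 * m := by
    rcases mul_eq_zero.1 hprod with h | h
    · linarith
    · exact absurd h hcubic.ne
  have hpv : (m + 1) * p = m - 1 := by
    have : (2 * m * (3 * m + 1)) * ((m + 1) * p) = (2 * m * (3 * m + 1)) * (m - 1) := by
      linear_combination (m + 1) ^ 2 * hQ - 2 * p * (m + 1) * (2 * m + 1) * hsv
        + (((m + 1) * s) ^ 2 + 2 * m * ((m + 1) * s) + 4 * m ^ 2 - (m + 1) ^ 2) * hsv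
    exact mul_left_cancel₀ (by positivity) this
  refine ⟨hs ▸ hsv, hp ▸ hpv, ?_⟩
  have : (2 * m * (m - 1)) * ((m + 1) * x) = (2 * m * (m - 1)) * (m - 1) := by
    linear_combination (m + 1) ^ 2 * hx - (m - 1) * x * (m + 1) * hsv
      + 2 * (m * (m + 1) - (m + 1) * s) * hpv - 2 * (m - 1) * hsv
  exact mul_left_cancel₀ (mul_pos (mul_pos two_pos hm0) (by linarith)).ne' this

/-- The solutions of the Einstein equations of `isEinstein_diagForm_iff`. -/
lemma einstein_system_iff (hm : 3 ≤ m) {x u v z : ℝ} (hx : 0 < x) (hu : 0 < u) (hv : 0 < v)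
    (hz : 0 < z) :
    (∃ lam : ℝ, ric₁ m x u v = lam * x ∧ ric₁₂ m x u v z = lam * u ∧
        ric₁₂ m x v u z = lam * v ∧ ric₂₃ m u v z = lam * z) ↔
      ∃ c : ℝ, 0 < c ∧
        ((x = c ∧ u = c ∧ v = c ∧ z = c) ∨
         (x = c * ((m - 1) / (m + 1)) ∧ u = c ∧ v = c * ((m - 1) / (m + 1)) ∧ z = c) ∨
         (x = c * ((m - 1) / (m + 1)) ∧ u = c * ((m - 1) / (m + 1)) ∧ v = c ∧ z = c) ∨
         (x = c * ((m - 2) * (m + 1) ^ 2 / (m ^ 3 + 4 * m ^ 2 + 5 * m - 2)) ∧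
          u = c * ((m + 1) * (m ^ 2 + m + 2) / (m ^ 3 + 4 * m ^ 2 + 5 * m - 2)) ∧
          v = c * ((m + 1) * (m ^ 2 + m + 2) / (m ^ 3 + 4 * m ^ 2 + 5 * m - 2)) ∧ z = c)) := by
  have hm0 : 0 < m := by linarith
  have hm1 : 0 < m - 1 := by linarith
  have hm2 : 0 < m - 2 := by linarith
  have hd : 0 < m ^ 3 + 4 * m ^ 2 + 5 * m - 2 := by
    have : 0 < m ^ 3 + 4 * m ^ 2 := by positivity
    linarith
  obtain ⟨d, hdm⟩ : ∃ d, d = m ^ 3 + 4 * m ^ 2 + 5 * m - 2 := ⟨_, rfl⟩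
  rw [← hdm] at hd ⊢
  constructor
  · rintro ⟨lam, e1, e2, e3, e4⟩
    -- scale to `x₂₃ = 1`
    obtain ⟨X, rfl⟩ : ∃ X, x = z * X := ⟨x / z, by field_simp⟩
    obtain ⟨U, rfl⟩ : ∃ U, u = z * U := ⟨u / z, by field_simp⟩
    obtain ⟨V, rfl⟩ : ∃ V, v = z * V := ⟨v / z, by field_simp⟩
    have hX := pos_of_mul_pos_right hx hz.le
    have hU := pos_of_mul_pos_right hu hz.le
    have hV := pos_of_mul_pos_right hv hz.le
    obtain ⟨L, rfl⟩ : ∃ L, lam = L / (4 * z) := ⟨4 * z * lam, by field_simp⟩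
    refine ⟨z, hz, ?_⟩
    have f1 : (m - 2) * (U * V) ^ 2 + X ^ 2 * (U ^ 2 + V ^ 2) = L * X * (U * V) ^ 2 := by
      rw [ric₁] at e1; field_simp at e1; linear_combination e1
    have f2 : (m - 1) * (2 * U - X) * V + U * (U ^ 2 - (1 - V) ^ 2) = L * U ^ 2 * V := by
      rw [ric₁₂] at e2; field_simp at e2
      exact mul_left_cancel₀ hX.ne' (by linear_combination e2)
    have f3 : (m - 1) * (2 * V - X) * U + V * (V ^ 2 - (1 - U) ^ 2) = L * V ^ 2 * U := by
      rw [ric₁₂] at e3; field_simp at e3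
      exact mul_left_cancel₀ hX.ne' (by linear_combination e3)
    have f4 : m * (1 - (V - U) ^ 2) = L * (U * V) := by
      rw [ric₂₃] at e4; field_simp at e4; linear_combination e4
    by_cases hUV : U = V
    · subst hUV
      obtain ⟨h | h, h'⟩ := einstein_solve_of_eq (m := m) (x := X) (u := U) (L := L)
        (mul_left_cancel₀ (pow_ne_zero 2 hU.ne') (by linear_combination f1))
        (mul_left_cancel₀ hU.ne' (by linear_combination f2)) (by linear_combination f4)
      · subst h
        have : X = 1 := mul_left_cancel₀ (by positivity : m + 1 ≠ 0) (by linear_combination h')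
        subst this
        simp
      · have hU' : U = (m + 1) * (m ^ 2 + m + 2) / d := by
          rw [eq_div_iff hd.ne', hdm]
          linear_combination (m ^ 2 + m + 2) * h' + (m - 1) * h
        have hX' : X = (m - 2) * (m + 1) ^ 2 / d := by
          refine mul_left_cancel₀ (by positivity : m ^ 2 + m + 2 ≠ 0) ?_
          rw [h, hU']; ring
        exact Or.inr (Or.inr (Or.inr ⟨by rw [hX'], by rw [hU'], by rw [hU'], rfl⟩))
    · obtain ⟨hs, hp, hx'⟩ := einstein_solve_of_ne hm hU hV hUV f1 f2 f3 f4
      have hX' : X = (m - 1) / (m + 1) := by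
        rw [eq_div_iff (by positivity)]; linear_combination hx'
      have h1 : (U - 1) * (V - 1) = 0 := by
        refine mul_left_cancel₀ (by positivity : m + 1 ≠ 0) ?_
        linear_combination hp - hs
      rcases mul_eq_zero.1 h1 with h | h
      · obtain rfl : U = 1 := by linarith
        have hV' : V = (m - 1) / (m + 1) := by
          rw [eq_div_iff (by positivity)]; linear_combination hp
        exact Or.inr (Or.inl ⟨by rw [hX'], by ring, by rw [hV'], rfl⟩)
      · obtain rfl : V = 1 := by linarith
        have hU' : U = (m - 1) / (m + 1) := by
          rw [eq_div_iff (by positivity)]; linear_combination hp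
        exact Or.inr (Or.inr (Or.inl ⟨by rw [hX'], by rw [hU'], by ring, rfl⟩))
  · rintro ⟨c, hc, ⟨rfl, rfl, rfl, rfl⟩ | ⟨rfl, rfl, rfl, rfl⟩ | ⟨rfl, rfl, rfl, rfl⟩ |
      ⟨rfl, rfl, rfl, rfl⟩⟩
    · refine ⟨m / (4 * z), ?_, ?_, ?_, ?_⟩ <;>
        simp only [ric₁, ric₁₂, ric₂₃] <;> field_simp <;> ring
    · refine ⟨m * (m + 3) / (4 * (m + 1) * z), ?_, ?_, ?_, ?_⟩ <;>
        simp only [ric₁, ric₁₂, ric₂₃] <;> field_simp <;> ring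
    · refine ⟨m * (m + 3) / (4 * (m + 1) * z), ?_, ?_, ?_, ?_⟩ <;>
        simp only [ric₁, ric₁₂, ric₂₃] <;> field_simp <;> ring
    · refine ⟨m * d ^ 2 / (4 * z * ((m + 1) * (m ^ 2 + m + 2)) ^ 2), ?_, ?_, ?_, ?_⟩ <;>
        simp only [ric₁, ric₁₂, ric₂₃] <;> field_simp <;> subst hdm <;> ring

end EinsteinEquations

/-! ### The matrix exponential -/

section MatrixExponential

variable {n : ℕ}

/-- The norm on matrices only serves the proof; it induces the topology in which the exponential is
defined. -/
lemma matrix_exp_hasDerivAt (X : Matrix (Fin n) (Fin n) ℝ) (i j : Fin n) :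
    HasDerivAt (fun t : ℝ => NormedSpace.exp (t • X) i j) (X i j) 0 := by
  have h := open scoped Matrix.Norms.Operator in hasDerivAt_exp_smul_const X (0 : ℝ)
  rw [zero_smul, NormedSpace.exp_zero, one_mul] at h
  exact hasDerivAt_pi.1 (hasDerivAt_pi.1 h i) j

lemma matrix_exp_mulVec_eq_self {X : Matrix (Fin n) (Fin n) ℝ} {v : Fin n → ℝ}
    (h : X.mulVec v = 0) : (NormedSpace.exp X).mulVec v = v := by
  have hs : HasSum (fun k => (Nat.factorial k : ℝ)⁻¹ • X ^ k) (NormedSpace.exp X) :=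
    open scoped Matrix.Norms.Operator in NormedSpace.exp_series_hasSum_exp' (𝕂 := ℝ) X
  have h1 := hs.map ((Matrix.mulVecBilin ℝ ℝ).flip v).toAddMonoidHom
    (continuous_id.matrix_mulVec continuous_const)
  have h2 := hasSum_single (f := fun k => ((Nat.factorial k : ℝ)⁻¹ • X ^ k).mulVec v) 0 (by
    intro k hk
    obtain ⟨k, rfl⟩ := Nat.exists_eq_succ_of_ne_zero hk
    rw [pow_succ, Matrix.smul_mulVec, ← Matrix.mulVec_mulVec, h, Matrix.mulVec_zero, smul_zero])
  have := h1.unique h2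
  simpa using this

/-- A one-parameter group of matrices with a vanishing entry has an infinitesimal generator in
which that entry vanishes. -/
lemma matrix_apply_eq_zero_of_exp {X : Matrix (Fin n) (Fin n) ℝ} {i j : Fin n}
    (h : ∀ t : ℝ, NormedSpace.exp (t • X) i j = 0) : X i j = 0 := by
  have := matrix_exp_hasDerivAt X i j
  simp only [h] at this
  exact this.unique (hasDerivAt_const _ _)

/-- The exponential of a skew-symmetric matrix is special orthogonal. -/
lemma matrix_exp_mem_SO {X : Matrix (Fin n) (Fin n) ℝ} (h : X.transpose = -X) :
    NormedSpace.exp X ∈ Matrix.specialOrthogonalGroup (Fin n) ℝ := by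
  have key (Y : Matrix (Fin n) (Fin n) ℝ) (h : Y.transpose = -Y) :
      NormedSpace.exp Y * (NormedSpace.exp Y).transpose = 1 := by
    rw [← Matrix.exp_transpose, h, ← Matrix.exp_add_of_commute _ _ ((Commute.refl Y).neg_right),
      add_neg_cancel, NormedSpace.exp_zero]
  refine Matrix.mem_specialOrthogonalGroup_iff.2
    ⟨(Matrix.mem_orthogonalGroup_iff _ _).2 (key X h), ?_⟩
  -- `exp X` is the square of the orthogonal matrix `exp (X / 2)`, of determinant `±1`
  have hh := key ((1 / 2 : ℝ) • X) (by rw [Matrix.transpose_smul, h, smul_neg])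
  have hX : X = (1 / 2 : ℝ) • X + (1 / 2 : ℝ) • X := by rw [← add_smul]; norm_num
  rw [hX, Matrix.exp_add_of_commute _ _ rfl, Matrix.det_mul]
  have := congrArg Matrix.det hh
  rwa [Matrix.det_mul, Matrix.det_transpose, Matrix.det_one] at this

end MatrixExponential

/-! ### Subgroups of `SO(n)` -/

section SpecialOrthogonalSubgroups

variable {n : ℕ}

lemma SO_transpose_mul (A : SO n) : A.1.transpose * A.1 = 1 :=
  (Matrix.mem_orthogonalGroup_iff' _ _).1 A.2.1

lemma SO_inv_apply (A : SO n) (i j : Fin n) : (A⁻¹).1 i j = A.1 j i := rfl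

open Classical in
/-- The elements of `SOon P` agree with the identity matrix outside the block `P × P`; for the rows
this uses that the inverse is the transpose. -/
lemma SOon_apply {P : Fin n → Prop} {A : SO n} (hA : A ∈ SOon P) {i j : Fin n}
    (h : ¬ (P i ∧ P j)) : A.1 i j = if i = j then 1 else 0 := by
  have col {A : SO n} (hA : A ∈ SOon P) (i : Fin n) {j : Fin n} (hj : ¬ P j) :
      A.1 i j = if i = j then 1 else 0 := by
    have := congrFun (hA j hj) i
    simpa [Pi.single_apply] using this
  by_cases hj : P j
  · rw [← SO_inv_apply, col (inv_mem hA) j fun hi => h ⟨hi, hj⟩]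
    simp only [eq_comm]
  · exact col hA i hj

instance : CompactSpace (SO n) := by
  refine isCompact_iff_compactSpace.1 ?_
  have hb : IsCompact {M : Matrix (Fin n) (Fin n) ℝ |
      ∀ i, M i ∈ {v : Fin n → ℝ | ∀ j, v j ∈ Set.Icc (-1 : ℝ) 1}} :=
    isCompact_pi_infinite fun _ => isCompact_pi_infinite fun _ => isCompact_Icc
  refine hb.of_isClosed_subset ?_ ?_
  · have : (Matrix.specialOrthogonalGroup (Fin n) ℝ : Set (Matrix (Fin n) (Fin n) ℝ))
        = {M | M * M.transpose = 1} ∩ {M | M.det = 1} := by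
      ext M
      simp only [SetLike.mem_coe, Matrix.mem_specialOrthogonalGroup_iff,
        Matrix.mem_orthogonalGroup_iff, Set.mem_inter_iff, Set.mem_ofPred_eq]
    rw [this]
    exact (isClosed_eq (continuous_id.matrix_mul continuous_id.matrix_transpose)
      continuous_const).inter (isClosed_eq continuous_id.matrix_det continuous_const)
  · intro M hM i j
    have h1 := congrFun (congrFun ((Matrix.mem_orthogonalGroup_iff _ _).1 hM.1) i) i
    rw [Matrix.mul_apply, Matrix.one_apply_eq] at h1
    simp only [Matrix.transpose_apply] at h1
    have h2 := Finset.single_le_sum (f := fun k => M i k * M i k) (fun k _ => mul_self_nonneg _)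
      (Finset.mem_univ j)
    rw [h1] at h2
    exact abs_le.1 (abs_le_one_iff_mul_self_le_one.2 h2)

lemma isClosed_SOon (P : Fin n → Prop) : IsClosed (SOon P : Set (SO n)) := by
  have : (SOon P : Set (SO n)) =
      ⋂ j, ⋂ _ : ¬ P j, {A | A.1.mulVec (Pi.single j 1) = Pi.single j 1} := by
    ext A; simp only [Set.mem_iInter]; rfl
  rw [this]
  exact isClosed_iInter fun j => isClosed_iInter fun _ =>
    isClosed_eq (continuous_subtype_val.matrix_mulVec continuous_const) continuous_const

open Classical in
lemma SOon_commute {P : Fin n → Prop} {A A' : SO n} (hA : A ∈ SOon P)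
    (hA' : A' ∈ SOon fun i => ¬ P i) : Commute A A' := by
  have e1 (i j : Fin n) (h : ¬ (P i ∧ P j)) : (A.1 - 1) i j = 0 := by
    rw [Matrix.sub_apply, SOon_apply hA h, Matrix.one_apply, sub_self]
  have e2 (i j : Fin n) (h : P i ∨ P j) : (A'.1 - 1) i j = 0 := by
    rw [Matrix.sub_apply, SOon_apply hA' (by tauto), Matrix.one_apply, sub_self]
  have h1 : (A.1 - 1) * (A'.1 - 1) = 0 := by
    ext i j
    rw [Matrix.mul_apply]
    refine Finset.sum_eq_zero fun k _ => ?_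
    by_cases hk : P k
    · exact mul_eq_zero_of_right _ (e2 k j (Or.inl hk))
    · exact mul_eq_zero_of_left (e1 i k fun h => hk h.2) _
  have h2 : (A'.1 - 1) * (A.1 - 1) = 0 := by
    ext i j
    rw [Matrix.mul_apply]
    refine Finset.sum_eq_zero fun k _ => ?_
    by_cases hk : P k
    · exact mul_eq_zero_of_left (e2 i k (Or.inr hk)) _
    · exact mul_eq_zero_of_right _ (e1 k j fun h => hk h.1)
  refine Subtype.ext ?_
  have : A.1 * A'.1 - A'.1 * A.1 = (A.1 - 1) * (A'.1 - 1) - (A'.1 - 1) * (A.1 - 1) := by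
    noncomm_ring
  rw [h1, h2, sub_zero, sub_eq_zero] at this
  exact this

lemma mem_SOprod_iff {A : SO n} : A ∈ SOprod n ↔
    ∃ A₁ ∈ SOon B₁, ∃ A₂ ∈ SOon (fun i => ¬ B₁ i), A₁ * A₂ = A := by
  have := MonoidHom.noncommCoprod_range (SOon (n := n) B₁).subtype
    (SOon fun i => ¬ B₁ i).subtype fun A A' => SOon_commute A.2 A'.2
  rw [Subgroup.range_subtype, Subgroup.range_subtype] at this
  rw [SOprod, ← this]
  simp

/-- The group is closed as the image of a compact group under multiplication. -/
lemma isClosed_SOprod : IsClosed (SOprod n : Set (SO n)) := by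
  have : (SOprod n : Set (SO n)) = (fun A : SO n × SO n => A.1 * A.2) ''
      (((SOon B₁ : Subgroup (SO n)) : Set (SO n)) ×ˢ
        ((SOon fun i => ¬ B₁ i : Subgroup (SO n)) : Set (SO n))) := by
    ext A
    simp only [SetLike.mem_coe, mem_SOprod_iff, Set.mem_image, Set.mem_prod, Prod.exists]
    tauto
  rw [this]
  exact (((isClosed_SOon _).isCompact.prod (isClosed_SOon _).isCompact).image
    continuous_mul).isClosed

end SpecialOrthogonalSubgroups

/-! ### Natural reductivity for groups of block matrices -/

section NaturalReductivity

variable {n : ℕ}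

/-- The subalgebra of `𝔰𝔬(n)` of the matrices that are block diagonal for the partition of the
indices into those with and those without the property `p`. -/
def blockAlgebra (p : Fin n → Prop) : LieSubalgebra ℝ (so n) where
  carrier := {X | ∀ i j, ¬ (p i ↔ p j) → X.1 i j = 0}
  zero_mem' _ _ _ := rfl
  add_mem' {X Y} hX hY i j h := by rw [so_add_apply, hX i j h, hY i j h, add_zero]
  smul_mem' c X hX i j h := by rw [so_smul_apply, hX i j h, mul_zero]
  lie_mem' {X Y} hX hY i j h := by
    rw [so_lie_apply, ← Finset.sum_sub_distrib]
    refine Finset.sum_eq_zero fun k _ => ?_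
    by_cases hk : p i ↔ p k
    · rw [hX k j fun h' => h (hk.trans h'), hY k j fun h' => h (hk.trans h')]; ring
    · rw [hX i k hk, hY i k hk]; ring

/-- Entrywise multiplication by symmetric weights. -/
def entryScale (s : Fin n → Fin n → ℝ) (hs : ∀ i j, s i j = s j i) : so n →ₗ[ℝ] so n where
  toFun X := soOf (fun i j => s i j * X.1 i j) fun i j => by rw [hs j i, so_apply_swap X i j]; ring
  map_add' X Y := so_ext fun i j => by simp only [soOf_apply, so_add_apply]; ring
  map_smul' c X := so_ext fun i j => by
    simp only [soOf_apply, so_smul_apply, RingHom.id_apply]; ring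

lemma entryScale_apply (s : Fin n → Fin n → ℝ) (hs : ∀ i j, s i j = s j i) (X : so n)
    (i j : Fin n) : (entryScale s hs X).1 i j = s i j * X.1 i j := rfl

lemma entryForm_eq_entryScale (s : Fin n → Fin n → ℝ) (hs : ∀ i j, s i j = s j i) (X Y : so n) :
    entryForm s X Y = entryForm 1 (entryScale s hs X) Y := by
  simp only [entryForm_apply, entryScale_apply, Pi.one_apply, one_mul, mul_assoc]

lemma entryForm_one_eq_trace (X Y : so n) :
    entryForm 1 X Y = (X.1 * Y.1.transpose).trace := by
  simp only [entryForm_apply, Pi.one_apply, one_mul, Matrix.trace, Matrix.diag_apply,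
    Matrix.mul_apply, Matrix.transpose_apply]

/-- The form `∑ i j, X i j * Y i j` is invariant. -/
lemma entryForm_one_lie (Z X Y : so n) :
    entryForm 1 ⁅Z, X⁆ Y = -entryForm 1 X ⁅Z, Y⁆ := by
  have h (X Y : so n) : entryForm 1 X Y = -(X.1 * Y.1).trace := by
    rw [entryForm_one_eq_trace, (LieAlgebra.Orthogonal.mem_so _ _ _).1 Y.2, Matrix.mul_neg,
      Matrix.trace_neg]
  rw [h, h, LieSubalgebra.coe_bracket, LieSubalgebra.coe_bracket, Ring.lie_def, Ring.lie_def,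
    Matrix.sub_mul, Matrix.mul_sub, Matrix.trace_sub, Matrix.trace_sub, Matrix.mul_assoc,
    Matrix.trace_mul_comm Z.1, Matrix.mul_assoc, Matrix.mul_assoc]
  ring

lemma Ad_apply (A : SO n) (X : so n) (i j : Fin n) :
    (Ad A X).1 i j = ∑ k, ∑ l, A.1 i k * X.1 k l * A.1 j l := by
  simp only [Ad, Matrix.mul_apply, Matrix.transpose_apply, Finset.sum_mul]
  exact Finset.sum_comm

lemma Ad_sub (A : SO n) (X Y : so n) : Ad A (X - Y) = Ad A X - Ad A Y :=
  Subtype.ext (by simp [Ad, Matrix.mul_sub, Matrix.sub_mul])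

lemma entryForm_one_Ad (A : SO n) (X Y : so n) :
    entryForm 1 (Ad A X) (Ad A Y) = entryForm 1 X Y := by
  have h : (Ad A X).1 * (Ad A Y).1.transpose = A.1 * (X.1 * Y.1.transpose * A.1.transpose) := by
    simp only [Ad, Matrix.transpose_mul, Matrix.transpose_transpose, Matrix.mul_assoc]
    rw [← Matrix.mul_assoc A.1.transpose A.1, SO_transpose_mul, Matrix.one_mul]
  rw [entryForm_one_eq_trace, entryForm_one_eq_trace, h, Matrix.trace_mul_comm, Matrix.mul_assoc,
    SO_transpose_mul, Matrix.mul_one]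

variable {p : Fin n → Prop} {s : Fin n → Fin n → ℝ}

/-- Weights that are constant on blocks commute with the adjoint action of block matrices. -/
lemma entryScale_Ad (hs : ∀ i j, s i j = s j i) (hc : ∀ i k j, (p i ↔ p k) → s i j = s k j)
    {A : SO n} (hA : ∀ i j, ¬ (p i ↔ p j) → A.1 i j = 0) (X : so n) :
    entryScale s hs (Ad A X) = Ad A (entryScale s hs X) := by
  refine so_ext fun i j => ?_
  rw [entryScale_apply, Ad_apply, Ad_apply, Finset.mul_sum]
  refine Finset.sum_congr rfl fun k _ => ?_
  rw [Finset.mul_sum]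
  refine Finset.sum_congr rfl fun l _ => ?_
  rw [entryScale_apply]
  by_cases hik : p i ↔ p k
  · by_cases hjl : p j ↔ p l
    · rw [hc i k j hik, hs k j, hc j l k hjl, hs l k]; ring
    · rw [hA j l hjl]; ring
  · rw [hA i k hik]; ring

/-- Weights that are constant on blocks commute with the adjoint action of `blockAlgebra`. -/
lemma entryScale_lie (hs : ∀ i j, s i j = s j i) (hc : ∀ i k j, (p i ↔ p k) → s i j = s k j)
    {Z : so n} (hZ : Z ∈ blockAlgebra p) (X : so n) :
    entryScale s hs ⁅Z, X⁆ = ⁅Z, entryScale s hs X⁆ := by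
  refine so_ext fun i j => ?_
  rw [entryScale_apply, so_lie_apply, so_lie_apply, mul_sub, Finset.mul_sum, Finset.mul_sum]
  congr 1 <;> refine Finset.sum_congr rfl fun k _ => ?_ <;> rw [entryScale_apply]
  · by_cases h : p i ↔ p k
    · rw [hc i k j h]; ring
    · rw [hZ i k h]; ring
  · by_cases h : p j ↔ p k
    · rw [hs i j, hc j k i h, hs k i]; ring
    · rw [hZ k j fun h' => h h'.symm]; ring

/-- A subgroup of block matrices that contains the exponentials of `blockAlgebra p` has
`blockAlgebra p` as its Lie algebra. -/
lemma isLieAlgebraOf_blockAlgebra {L : Subgroup (SO n)}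
    (hL : ∀ A ∈ L, ∀ i j, ¬ (p i ↔ p j) → A.1 i j = 0)
    (hexp : ∀ X ∈ blockAlgebra p, ∃ A ∈ L, A.1 = NormedSpace.exp X.1) :
    IsLieAlgebraOf (blockAlgebra p) L := by
  intro X
  refine ⟨fun hX t => hexp (t • X) ((blockAlgebra p).smul_mem t hX), fun h i j hij => ?_⟩
  refine matrix_apply_eq_zero_of_exp fun t => ?_
  obtain ⟨A, hA, hAX⟩ := h t
  rw [← hAX]
  exact hL A hA i j hij

/-- The metric with weights `s` that are constant on the blocks and equal to one off the diagonal
blocks is naturally reductive with respect to `SO(n) × L`, for a closed group `L` of block matrices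
with Lie algebra `blockAlgebra p`. The complement of the isotropy algebra is
`{(S X, S X - X)}`, where `S` multiplies the entries by `s`; the differential of the orbit map sends
`(S X, S X - X)` to `X`. -/
theorem isNaturallyReductiveWrt_entryForm (c : ℝ) (hs : ∀ i j, s i j = s j i)
    (hc : ∀ i k j, (p i ↔ p k) → s i j = s k j) (hoff : ∀ i j, ¬ (p i ↔ p j) → s i j = 1)
    {L : Subgroup (SO n)} (hcl : IsClosed (L : Set (SO n)))
    (hL : ∀ A ∈ L, ∀ i j, ¬ (p i ↔ p j) → A.1 i j = 0)
    (hexp : ∀ X ∈ blockAlgebra p, ∃ A ∈ L, A.1 = NormedSpace.exp X.1) :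
    IsNaturallyReductiveWrt (c • entryForm s) L := by
  set S := entryScale s hs with hS
  have hT (X : so n) : S X - X ∈ blockAlgebra p := fun i j hij => by
    rw [so_sub_apply, hS, entryScale_apply, hoff i j hij]; ring
  let T : so n →ₗ[ℝ] blockAlgebra p := LinearMap.codRestrict (blockAlgebra p).toSubmodule
    (S - LinearMap.id) hT
  have hTX (X : so n) : (T X : so n) = S X - X := rfl
  let 𝔭 : Submodule ℝ (so n × blockAlgebra p) := LinearMap.range (LinearMap.prod S T)
  have hiso (W : so n × blockAlgebra p) :
      W ∈ isotropyAlgebra (blockAlgebra p) ↔ W.1 = W.2 := by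
    constructor
    · rintro ⟨Z, rfl⟩; rfl
    · intro h; exact ⟨W.2, Prod.ext h.symm rfl⟩
  have horb (W : so n × blockAlgebra p) : orbitDifferential (blockAlgebra p) W = W.1 - W.2 := rfl
  have horbp (X : so n) : orbitDifferential (blockAlgebra p) (LinearMap.prod S T X) = X := by
    rw [horb]; simp [hTX]
  have hcompl : IsCompl 𝔭 (isotropyAlgebra (blockAlgebra p)) := by
    constructor
    · rw [Submodule.disjoint_def]
      rintro _ ⟨X, rfl⟩ hW
      have : X = 0 := by
        rw [← horbp X, horb, (hiso _).1 hW, sub_self]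
      rw [this, map_zero]
    · rw [codisjoint_iff, eq_top_iff]
      rintro ⟨V, W⟩ -
      refine Submodule.mem_sup.2 ⟨LinearMap.prod S T (V - W), ⟨_, rfl⟩,
        (V, W) - LinearMap.prod S T (V - W), (hiso _).2 ?_, add_sub_cancel _ _⟩
      simp only [LinearMap.prod_apply, Function.prod, Prod.fst_sub, Prod.snd_sub,
        AddSubgroupClass.coe_sub, hTX, map_sub]
      abel
  refine ⟨hcl, fun A hA X Y => ?_, blockAlgebra p, isLieAlgebraOf_blockAlgebra hL hexp,
    𝔭, hcompl, ?_, ?_⟩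
  · rw [LinearMap.smul_apply, LinearMap.smul_apply, LinearMap.smul_apply, LinearMap.smul_apply,
      entryForm_eq_entryScale s hs, entryForm_eq_entryScale s hs, entryScale_Ad hs hc (hL A hA),
      entryForm_one_Ad]
  · rintro A hA _ ⟨X, rfl⟩ W' h1 h2
    refine ⟨Ad A X, Prod.ext ?_ (Subtype.ext ?_)⟩
    · rw [h1]; exact entryScale_Ad hs hc (hL A hA) X
    · rw [h2]
      change S (Ad A X) - Ad A X = Ad A (S X - X)
      rw [Ad_sub, hS, entryScale_Ad hs hc (hL A hA) X]
  · -- the projection to `𝔭` does not change the value of the differential of the orbit map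
    have hproj (W : so n × blockAlgebra p) : orbitDifferential (blockAlgebra p)
        (Submodule.projection 𝔭 (isotropyAlgebra (blockAlgebra p)) hcompl W) = W.1 - W.2 := by
      have h1 : W - Submodule.projection 𝔭 (isotropyAlgebra (blockAlgebra p)) hcompl W
          ∈ isotropyAlgebra (blockAlgebra p) := by
        rw [← Submodule.projection_apply_eq_zero_iff hcompl, map_sub,
          Submodule.projection_apply_of_mem_left hcompl (Submodule.projection_apply_mem hcompl W),
          sub_self]
      have h2 : orbitDifferential (blockAlgebra p)
          (W - Submodule.projection 𝔭 (isotropyAlgebra (blockAlgebra p)) hcompl W) = 0 := by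
        rw [horb, (hiso _).1 h1, sub_self]
      rw [map_sub, sub_eq_zero] at h2
      rw [← h2, horb]
    have hbr (X Y : so n) : (⁅LinearMap.prod S T X, LinearMap.prod S T Y⁆ : so n × _).1
        - ((⁅LinearMap.prod S T X, LinearMap.prod S T Y⁆ : so n × blockAlgebra p).2 : so n)
        = ⁅S X - X, Y⁆ + ⁅X, S Y⁆ := by
      change ⁅S X, S Y⁆ - ⁅S X - X, S Y - Y⁆ = _
      simp only [sub_lie, lie_sub]; abel
    rintro _ ⟨X, rfl⟩ _ ⟨Y, rfl⟩ _ ⟨Z, rfl⟩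
    simp only [LinearMap.compl₁₂_apply, hproj, horbp, hbr, LinearMap.smul_apply, smul_eq_mul]
    have e1 : entryForm s ⁅S X - X, Y⁆ Z = -entryForm s Y ⁅S X - X, Z⁆ := by
      rw [entryForm_eq_entryScale s hs, entryScale_lie hs hc (hT X), entryForm_one_lie,
        ← entryForm_eq_entryScale]
    have e2 : entryForm s ⁅X, S Y⁆ Z = -entryForm s Y ⁅X, S Z⁆ := by
      rw [entryForm_symm, entryForm_eq_entryScale s hs, entryForm_symm, entryForm_one_lie,
        ← entryForm_eq_entryScale]
    rw [map_add, map_add, LinearMap.add_apply, e1, e2]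
    ring

end NaturalReductivity

/-! ### The Einstein metrics are naturally reductive -/

section DiagonalForms

variable {n : ℕ} {p : Fin n → Prop}

open Classical in
/-- Weights that depend only on the block: `a` where `p` holds, `b` where it does not, and `1` off
the diagonal blocks. -/
def twoBlockWeight (p : Fin n → Prop) (a b : ℝ) (i j : Fin n) : ℝ :=
  if p i then if p j then a else 1 else if p j then 1 else b

lemma twoBlockWeight_symm (p : Fin n → Prop) (a b : ℝ) (i j : Fin n) :
    twoBlockWeight p a b i j = twoBlockWeight p a b j i := by
  unfold twoBlockWeight; split_ifs <;> rfl

lemma twoBlockWeight_congr (a b : ℝ) (i k j : Fin n) (h : p i ↔ p k) :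
    twoBlockWeight p a b i j = twoBlockWeight p a b k j := by
  unfold twoBlockWeight; split_ifs <;> tauto

lemma twoBlockWeight_off (a b : ℝ) (i j : Fin n) (h : ¬ (p i ↔ p j)) :
    twoBlockWeight p a b i j = 1 := by
  unfold twoBlockWeight; split_ifs <;> tauto

/-- The exponential of a skew matrix, as an element of `SO(n)`. -/
def soExp (X : so n) : SO n :=
  ⟨NormedSpace.exp X.1, matrix_exp_mem_SO ((LieAlgebra.Orthogonal.mem_so _ _ _).1 X.2)⟩

/-- A skew matrix whose columns outside `P` vanish exponentiates into `SOon P`. -/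
lemma soExp_mem_SOon {P : Fin n → Prop} {X : so n} (hX : ∀ i j, ¬ P j → X.1 i j = 0) :
    soExp X ∈ SOon P := fun j hj => matrix_exp_mulVec_eq_self (by
  ext i
  simp [hX i j hj])

/-- If `p` holds for at most one index, then `SO` of the other indices has the Lie algebra
`blockAlgebra p`. -/
lemma isNaturallyReductiveWrt_SOon (hp : ∀ i j, p i → p j → i = j) (c a b : ℝ) :
    IsNaturallyReductiveWrt (c • entryForm (twoBlockWeight p a b)) (SOon fun i => ¬ p i) := by
  refine isNaturallyReductiveWrt_entryForm (p := p) c (twoBlockWeight_symm p a b)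
    (twoBlockWeight_congr a b) (twoBlockWeight_off a b) (isClosed_SOon _) ?_ ?_
  · intro A hA i j hij
    rw [SOon_apply hA (by tauto), if_neg]
    rintro rfl
    exact hij Iff.rfl
  · refine fun X hX => ⟨soExp X, soExp_mem_SOon fun i j hj => ?_, rfl⟩
    rw [not_not] at hj
    by_cases hi : p i
    · rw [hp i j hi hj, so_apply_self]
    · exact hX i j (by tauto)

lemma isNaturallyReductiveWrt_SOprod (c a b : ℝ) :
    IsNaturallyReductiveWrt (c • entryForm (twoBlockWeight (B₁ (n := n)) a b)) (SOprod n) := by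
  refine isNaturallyReductiveWrt_entryForm (p := B₁) c (twoBlockWeight_symm _ a b)
    (twoBlockWeight_congr a b) (twoBlockWeight_off a b) isClosed_SOprod ?_ ?_
  · intro A hA i j hij
    obtain ⟨A₁, h₁, A₂, h₂, rfl⟩ := mem_SOprod_iff.1 hA
    change ∑ k, A₁.1 i k * A₂.1 k j = 0
    refine Finset.sum_eq_zero fun k _ => ?_
    by_cases hk : B₁ k ↔ B₁ i
    · have hkj : k ≠ j := fun h => hij (h ▸ hk.symm)
      rw [SOon_apply h₂ (by tauto), if_neg hkj, mul_zero]
    · have hik : i ≠ k := fun h => hk (h ▸ Iff.rfl)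
      rw [SOon_apply h₁ (by tauto), if_neg hik, zero_mul]
  · intro X hX
    classical
    let X₁ : so n := entryScale (fun i j => if B₁ i ∧ B₁ j then 1 else 0)
      (fun i j => by simp only [and_comm]) X
    let X₂ : so n := entryScale (fun i j => if ¬ B₁ i ∧ ¬ B₁ j then 1 else 0)
      (fun i j => by simp only [and_comm]) X
    have e₁ (i j : Fin n) : X₁.1 i j = (if B₁ i ∧ B₁ j then 1 else 0) * X.1 i j := rfl
    have e₂ (i j : Fin n) : X₂.1 i j = (if ¬ B₁ i ∧ ¬ B₁ j then 1 else 0) * X.1 i j := rfl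
    have hsum : X.1 = X₁.1 + X₂.1 := by
      ext i j
      rw [Matrix.add_apply, e₁, e₂]
      by_cases hi : B₁ i <;> by_cases hj : B₁ j
      · simp [hi, hj]
      · simp [hX i j (by tauto)]
      · simp [hX i j (by tauto)]
      · simp [hi, hj]
    have h12 : X₁.1 * X₂.1 = 0 := by
      ext i j
      rw [Matrix.mul_apply]
      refine Finset.sum_eq_zero fun k _ => ?_
      rw [e₁, e₂]
      by_cases hk : B₁ k <;> simp [hk]
    have h21 : X₂.1 * X₁.1 = 0 := by
      ext i j
      rw [Matrix.mul_apply]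
      refine Finset.sum_eq_zero fun k _ => ?_
      rw [e₁, e₂]
      by_cases hk : B₁ k <;> simp [hk]
    refine ⟨soExp X₁ * soExp X₂, mem_SOprod_iff.2 ⟨_, soExp_mem_SOon fun i j hj => ?_,
      _, soExp_mem_SOon fun i j hj => ?_, rfl⟩, ?_⟩
    · rw [e₁, if_neg (by tauto), zero_mul]
    · rw [e₂, if_neg (by tauto), zero_mul]
    · change NormedSpace.exp X₁.1 * NormedSpace.exp X₂.1 = _
      rw [hsum, Matrix.exp_add_of_commute _ _ (h12.trans h21.symm)]

lemma isNaturallyReductiveWrt_top (c : ℝ) :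
    IsNaturallyReductiveWrt (c • entryForm (n := n) fun _ _ => 1) ⊤ :=
  isNaturallyReductiveWrt_entryForm (p := fun _ => True) c (fun _ _ => rfl) (fun _ _ _ _ => rfl)
    (fun _ _ _ => rfl) isClosed_univ (fun _ _ _ _ h => (h Iff.rfl).elim)
    fun X _ => ⟨soExp X, trivial, rfl⟩

lemma diagForm_const (c : ℝ) :
    diagForm n c c c c = (((n : ℝ) - 2) * c) • entryForm fun _ _ => 1 := by
  rw [diagForm_eq, mul_smul, entryForm_smul c]
  congr 2; ext i j; unfold blockWeight; split_ifs <;> ring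

/-- The block of the single index with `B₂` has no off-diagonal entries, so that its weight `1` is
arbitrary; likewise for `B₃` below. -/
lemma diagForm_eq_twoBlockWeight_B₂ (a c : ℝ) : diagForm n (c * a) c (c * a) c
    = (((n : ℝ) - 2) * c) • entryForm (twoBlockWeight B₂ 1 a) := by
  rw [diagForm_eq, mul_smul, entryForm_smul c]
  congr 1
  refine entryForm_congr fun i j hij => ?_
  unfold blockWeight twoBlockWeight
  rcases block_cases i with ⟨hi₁, hi₂, hi₃⟩ | ⟨hi₁, hi₂, hi₃⟩ | ⟨hi₁, hi₂, hi₃⟩ <;>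
    rcases block_cases j with ⟨hj₁, hj₂, hj₃⟩ | ⟨hj₁, hj₂, hj₃⟩ | ⟨hj₁, hj₂, hj₃⟩ <;>
    first
    | exact absurd (hi₂.eq hj₂) hij
    | exact absurd (hi₃.eq hj₃) hij
    | simp [hi₁, hi₂, hj₁, hj₂]

lemma diagForm_eq_twoBlockWeight_B₃ (a c : ℝ) : diagForm n (c * a) (c * a) c c
    = (((n : ℝ) - 2) * c) • entryForm (twoBlockWeight B₃ 1 a) := by
  rw [diagForm_eq, mul_smul, entryForm_smul c]
  congr 1
  refine entryForm_congr fun i j hij => ?_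
  unfold blockWeight twoBlockWeight
  rcases block_cases i with ⟨hi₁, hi₂, hi₃⟩ | ⟨hi₁, hi₂, hi₃⟩ | ⟨hi₁, hi₂, hi₃⟩ <;>
    rcases block_cases j with ⟨hj₁, hj₂, hj₃⟩ | ⟨hj₁, hj₂, hj₃⟩ | ⟨hj₁, hj₂, hj₃⟩ <;>
    first
    | exact absurd (hi₂.eq hj₂) hij
    | exact absurd (hi₃.eq hj₃) hij
    | simp [hi₁, hi₂, hi₃, hj₁, hj₂, hj₃]

lemma diagForm_eq_twoBlockWeight_B₁ (a b c : ℝ) : diagForm n (c * a) c c (c * b)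
    = (((n : ℝ) - 2) * c) • entryForm (twoBlockWeight B₁ a b) := by
  rw [diagForm_eq, mul_smul, entryForm_smul c]
  congr 1
  refine entryForm_congr fun i j hij => ?_
  unfold blockWeight twoBlockWeight; split_ifs <;> ring

end DiagonalForms

end

theorem proposition7p2 (n : ℕ) (hn : 5 ≤ n) :
    (∀ x₁ x₁₂ x₁₃ x₂₃ : ℝ, 0 < x₁ → 0 < x₁₂ → 0 < x₁₃ → 0 < x₂₃ →
      -- the Ricci tensor is diagonal
      (∃ r₁ r₁₂ r₁₃ r₂₃ : ℝ,
        IsRicciTensorOf (diagForm n r₁ r₁₂ r₁₃ r₂₃) (diagForm n x₁ x₁₂ x₁₃ x₂₃)) ∧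
      -- Einstein metrics are naturally reductive
      (IsEinstein (diagForm n x₁ x₁₂ x₁₃ x₂₃) →
        IsNaturallyReductive (diagForm n x₁ x₁₂ x₁₃ x₂₃)) ∧
      -- the Einstein metrics, up to a positive factor
      (IsEinstein (diagForm n x₁ x₁₂ x₁₃ x₂₃) ↔
        ∃ c : ℝ, 0 < c ∧
          ((x₁ = c ∧ x₁₂ = c ∧ x₁₃ = c ∧ x₂₃ = c) ∨
           (x₁ = c * einsteinAlpha n ∧ x₁₂ = c ∧ x₁₃ = c * einsteinAlpha n ∧ x₂₃ = c) ∨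
           (x₁ = c * einsteinAlpha n ∧ x₁₂ = c * einsteinAlpha n ∧ x₁₃ = c ∧ x₂₃ = c) ∨
           (x₁ = c * einsteinBeta n ∧ x₁₂ = c * einsteinGamma n ∧ x₁₃ = c * einsteinGamma n ∧ x₂₃ = c)))) ∧
    -- the groups with respect to which these metrics are naturally reductive
    (∀ c : ℝ, 0 < c →
      IsNaturallyReductiveWrt (diagForm n c c c c) ⊤ ∧
      IsNaturallyReductiveWrt (diagForm n (c * einsteinAlpha n) c (c * einsteinAlpha n) c) (SO₁₃ n) ∧
      IsNaturallyReductiveWrt (diagForm n (c * einsteinAlpha n) (c * einsteinAlpha n) c c) (SO₁₂ n) ∧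
      IsNaturallyReductiveWrt (diagForm n (c * einsteinBeta n) (c * einsteinGamma n) (c * einsteinGamma n) c)
        (SOprod n)) := by
  obtain ⟨m, rfl⟩ : ∃ m, n = m + 2 := ⟨n - 2, by omega⟩
  have hm : 3 ≤ m := by omega
  have hm' : (3 : ℝ) ≤ m := by exact_mod_cast hm
  have hα : einsteinAlpha (m + 2) = ((m : ℝ) - 1) / (m + 1) := by
    rw [einsteinAlpha]; push_cast; congr 1 <;> ring
  have hβ : einsteinBeta (m + 2)
      = ((m : ℝ) - 2) * (m + 1) ^ 2 / (m ^ 3 + 4 * m ^ 2 + 5 * m - 2) := by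
    rw [einsteinBeta]; push_cast; congr 1 <;> ring
  have hγ : einsteinGamma (m + 2)
      = ((m : ℝ) + 1) * (m ^ 2 + m + 2) / (m ^ 3 + 4 * m ^ 2 + 5 * m - 2) := by
    rw [einsteinGamma]; push_cast; congr 1 <;> ring
  have hγ0 : einsteinGamma (m + 2) ≠ 0 := by
    have h1 : (0 : ℝ) < m ^ 3 + 4 * m ^ 2 := by positivity
    rw [hγ]
    exact (div_pos (by positivity) (by linarith)).ne'
  have hiff (x₁ x₁₂ x₁₃ x₂₃ : ℝ) (h₁ : 0 < x₁) (h₁₂ : 0 < x₁₂) (h₁₃ : 0 < x₁₃) (h₂₃ : 0 < x₂₃) :=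
    (isEinstein_diagForm_iff hm h₁ h₁₂ h₁₃ h₂₃).trans (einstein_system_iff hm' h₁ h₁₂ h₁₃ h₂₃)
  simp only [← hα, ← hβ, ← hγ] at hiff
  have hnat (c : ℝ) : IsNaturallyReductiveWrt (diagForm (m + 2) c c c c) ⊤ ∧
      IsNaturallyReductiveWrt (diagForm (m + 2) (c * einsteinAlpha (m + 2)) c
        (c * einsteinAlpha (m + 2)) c) (SO₁₃ (m + 2)) ∧
      IsNaturallyReductiveWrt (diagForm (m + 2) (c * einsteinAlpha (m + 2))
        (c * einsteinAlpha (m + 2)) c c) (SO₁₂ (m + 2)) ∧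
      IsNaturallyReductiveWrt (diagForm (m + 2) (c * einsteinBeta (m + 2))
        (c * einsteinGamma (m + 2)) (c * einsteinGamma (m + 2)) c) (SOprod (m + 2)) := by
    refine ⟨?_, ?_, ?_, ?_⟩
    · rw [diagForm_const]
      exact isNaturallyReductiveWrt_top _
    · rw [diagForm_eq_twoBlockWeight_B₂]
      exact isNaturallyReductiveWrt_SOon (fun _ _ => B₂.eq) _ _ _
    · rw [diagForm_eq_twoBlockWeight_B₃]
      exact isNaturallyReductiveWrt_SOon (fun _ _ => B₃.eq) _ _ _
    · have := diagForm_eq_twoBlockWeight_B₁ (n := m + 2)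
        (einsteinBeta (m + 2) / einsteinGamma (m + 2)) (1 / einsteinGamma (m + 2))
        (c * einsteinGamma (m + 2))
      rw [mul_assoc, mul_assoc, mul_div_cancel₀ _ hγ0, mul_div_cancel₀ _ hγ0, mul_one] at this
      rw [this]
      exact isNaturallyReductiveWrt_SOprod _ _ _
  refine ⟨fun x₁ x₁₂ x₁₃ x₂₃ h₁ h₁₂ h₁₃ h₂₃ => ⟨⟨_, _, _, _,
    isRicciTensorOf_diagForm (by omega) h₁ h₁₂ h₁₃ h₂₃⟩, fun h => ?_, hiff _ _ _ _ h₁ h₁₂ h₁₃ h₂₃⟩,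
    fun c _ => hnat c⟩
  obtain ⟨c, -, ⟨rfl, rfl, rfl, rfl⟩ | ⟨rfl, rfl, rfl, rfl⟩ | ⟨rfl, rfl, rfl, rfl⟩ |
    ⟨rfl, rfl, rfl, rfl⟩⟩ := (hiff _ _ _ _ h₁ h₁₂ h₁₃ h₂₃).1 h
  exacts [⟨_, (hnat _).1⟩, ⟨_, (hnat _).2.1⟩, ⟨_, (hnat _).2.2.1⟩, ⟨_, (hnat _).2.2.2⟩]
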